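/- Let $M$ be a smooth (finite-dimensional, Hausdorff, boundaryless) manifold and let $X$ be a smooth complete vector field on $M$, that is, through every point of $M$ there is an integral curve of $X$ defined on all of $\mathbb{R}$. Let $\varphi_X^t(q)$ be the value at time $t$ of the integral curve of $X$ starting at $q$. For a diffeomorphism $\Phi : M \to M$ let $\hat\Phi : T^*M \to T^*M$ be its lift, which maps a covector $p_q \in T_q^*M$ to $(\Phi^{-1})^* p_q = p_q \circ d(\Phi^{-1})_{\Phi(q)} \in T^*_{\Phi(q)}M$. Let $\theta$ be the tautological $1$-form on $T^*M$, $\theta_p(v) = p(d\pi_p(v))$, where $\pi : T^*M \to M$ is the projection, and let $\alpha = -d\theta$. The cotangent lift $\hat X$ of $X$ is given by $$\hat X_p = \frac{d}{dt}\Big|_{t=0} \widehat{(\varphi_X^t)}(p), \qquad p \in T^*M.$$ Then: 1. $(\varphi_X^t)_{t\in\mathbb{R}}$ is a smooth global flow on $M$ (a smooth action of $\mathbb{R}$), and its lifts $\big(\widehat{(\varphi_X^t)}\big)_{t\in\mathbb{R}}$ form a smooth global flow on $T^*M$. 2. $\hat X$ is a smooth complete vector field on $T^*M$ that generates the lifted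 flow: $\varphi_{\hat X}^t = \widehat{(\varphi_X^t)}$ for all $t \in \mathbb{R}$. 3. $\alpha$ is a symplectic form on $T^*M$ (smooth, closed and nondegenerate), and $\hat X$ is the Hamiltonian vector field with respect to $\alpha$ of the smooth function $H_X : T^*M \to \mathbb{R}$, $H_X(p_q) = p_q(X_q)$; that is, $\alpha(\hat X, \cdot) = dH_X$. -/

import Mathlib

open Bundle Set Function
open scoped Manifold ContDiff Topology

noncomputable section

/-! ### Vector fields and flows -/

section Flows

variable {E : Type*} [NormedAddCommGroup E] [NormedSpace ℝ E]
  {H : Type*} [TopologicalSpace H] (I : ModelWithCorners ℝ E H)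
  {N : Type*} [TopologicalSpace N] [ChartedSpace H N]

/-- A smooth vector field on `N`: a smooth section of the tangent bundle. -/
def IsSmoothVectorField [IsManifold I 1 N] (X : (x : N) → TangentSpace I x) : Prop :=
  ContMDiff I I.tangent ∞ (fun x ↦ (⟨x, X x⟩ : TangentBundle I N))

/-- A vector field is complete if through every point there is an integral curve that is defined
for all times. -/
def IsCompleteVectorField (X : (x : N) → TangentSpace I x) : Prop :=
  ∀ x : N, ∃ γ : ℝ → N, γ 0 = x ∧ IsMIntegralCurve (I := I) γ X

/-- The flow of a complete vector field: `flowOf I X hX t x` is the value at time `t` of the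
integral curve of `X` that starts at `x`. (This curve is unique on a Hausdorff manifold without
boundary if `X` is smooth.) -/
def flowOf (X : (x : N) → TangentSpace I x) (hX : IsCompleteVectorField I X) (t : ℝ) (x : N) : N :=
  (hX x).choose t

variable {I}

theorem flowOf_zero {X : (x : N) → TangentSpace I x} (hX : IsCompleteVectorField I X) (x : N) :
    flowOf I X hX 0 x = x :=
  (hX x).choose_spec.1

theorem isMIntegralCurve_flowOf {X : (x : N) → TangentSpace I x}
    (hX : IsCompleteVectorField I X) (x : N) :
    IsMIntegralCurve (I := I) (fun t ↦ flowOf I X hX t x) X :=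
  (hX x).choose_spec.2

theorem flowOf_add [IsManifold I 1 N] [BoundarylessManifold I N] [T2Space N] [FiniteDimensional ℝ E]
    {X : (x : N) → TangentSpace I x} (hXs : IsSmoothVectorField I X)
    (hX : IsCompleteVectorField I X) (s t : ℝ) (x : N) :
    flowOf I X hX s (flowOf I X hX t x) = flowOf I X hX (s + t) x := by
  have : CompleteSpace E := FiniteDimensional.complete ℝ E
  have h := isMIntegralCurve_Ioo_eq_of_contMDiff_boundaryless (t₀ := (0 : ℝ))
    (ContMDiff.of_le hXs (by simp)) (isMIntegralCurve_flowOf hX (flowOf I X hX t x))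
    ((isMIntegralCurve_flowOf hX x).comp_add t) (by simp [flowOf_zero])
  exact congrFun h s

variable (I)

/-- The time-`t` map of the flow of a smooth complete vector field, as a bijection of the manifold
with inverse the time-`(-t)` map. -/
def flowEquiv [IsManifold I 1 N] [BoundarylessManifold I N] [T2Space N] [FiniteDimensional ℝ E]
    (X : (x : N) → TangentSpace I x) (hXs : IsSmoothVectorField I X)
    (hX : IsCompleteVectorField I X) (t : ℝ) : N ≃ N where
  toFun := flowOf I X hX t
  invFun := flowOf I X hX (-t)
  left_inv x := by rw [flowOf_add hXs, neg_add_cancel, flowOf_zero]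
  right_inv x := by rw [flowOf_add hXs, add_neg_cancel, flowOf_zero]

/-- A smooth global flow on `N`: a smooth action of the additive group `ℝ` on `N`. -/
structure IsSmoothGlobalFlow (φ : ℝ → N → N) : Prop where
  smooth : ContMDiff (𝓘(ℝ, ℝ).prod I) I ∞ (fun z : ℝ × N ↦ φ z.1 z.2)
  zero : ∀ x, φ 0 x = x
  add : ∀ s t x, φ s (φ t x) = φ (s + t) x

end Flows

/-! ### Differential forms, symplectic forms, Hamiltonian vector fields -/

section Forms

variable {E : Type*} [NormedAddCommGroup E] [NormedSpace ℝ E]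
  {H : Type*} [TopologicalSpace H] (I : ModelWithCorners ℝ E H)
  {N : Type*} [TopologicalSpace N] [ChartedSpace H N]

/-- The expression of a differential `k`-form on `N` in the preferred chart at `x₀`: its pullback
under the inverse of this chart, a `k`-form on the model vector space. -/
def formInChart {k : ℕ} (α : (x : N) → TangentSpace I x [⋀^Fin k]→L[ℝ] ℝ) (x₀ : N) :
    E → E [⋀^Fin k]→L[ℝ] ℝ :=
  fun y ↦ (α ((extChartAt I x₀).symm y)).compContinuousLinearMap
    (mfderivWithin 𝓘(ℝ, E) I (extChartAt I x₀).symm (range I) y)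

/-- A differential form on `N` is smooth if it is smooth in the charts. -/
def IsSmoothForm {k : ℕ} (α : (x : N) → TangentSpace I x [⋀^Fin k]→L[ℝ] ℝ) : Prop :=
  ∀ x₀ : N, ContDiffOn ℝ ∞ (formInChart I α x₀) (extChartAt I x₀).target

/-- The exterior derivative of a differential form on `N`, computed at `x` in the preferred chart
at `x`, and pulled back to `N` by this chart. -/
def extDerivForm {k : ℕ} (α : (x : N) → TangentSpace I x [⋀^Fin k]→L[ℝ] ℝ) (x : N) :
    TangentSpace I x [⋀^Fin (k + 1)]→L[ℝ] ℝ :=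
  (extDerivWithin (formInChart I α x) (range I) (extChartAt I x x)).compContinuousLinearMap
    (mfderiv I 𝓘(ℝ, E) (extChartAt I x) x)

/-- A symplectic form: a smooth closed `2`-form `α` such that `v ↦ α (v, ·)` is an isomorphism from
the tangent space to its dual, at every point. -/
structure IsSymplecticForm (α : (x : N) → TangentSpace I x [⋀^Fin 2]→L[ℝ] ℝ) : Prop where
  smooth : IsSmoothForm I α
  closed : ∀ x, extDerivForm I α x = 0
  nondegenerate : ∀ (x : N) (l : TangentSpace I x →L[ℝ] ℝ),
    ∃! v : TangentSpace I x, ∀ w : TangentSpace I x, α x ![v, w] = l w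

/-- `Y` is the Hamiltonian vector field with (smooth) Hamiltonian function `h` on the symplectic
manifold `(N, α)`: the contraction of `α` with `Y` is `dh`. -/
structure IsHamiltonianVectorField [IsManifold I 1 N]
    (α : (x : N) → TangentSpace I x [⋀^Fin 2]→L[ℝ] ℝ)
    (Y : (x : N) → TangentSpace I x) (h : N → ℝ) : Prop where
  symplectic : IsSymplecticForm I α
  smooth_field : IsSmoothVectorField I Y
  smooth_hamiltonian : ContMDiff I 𝓘(ℝ, ℝ) ∞ h
  contraction : ∀ (x : N) (w : TangentSpace I x), α x ![Y x, w] = mfderiv I 𝓘(ℝ, ℝ) h x w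

end Forms

/-! ### The cotangent bundle -/

section Cotangent

variable (E : Type*) [NormedAddCommGroup E] [NormedSpace ℝ E]
  (M : Type*) [TopologicalSpace M] [ChartedSpace E M] [IsManifold 𝓘(ℝ, E) ∞ M]

/-- The cotangent bundle of a manifold modelled on `E`: the total space of the bundle of continuous
linear functionals on the tangent spaces. -/
abbrev CotangentBundle : Type _ :=
  TotalSpace (E →L[ℝ] ℝ) (fun x : M ↦ TangentSpace 𝓘(ℝ, E) x →L[ℝ] Trivial M ℝ x)

/-- The model with corners of the cotangent bundle of a manifold modelled on `E`. -/
abbrev cotangentModel : ModelWithCorners ℝ (E × (E →L[ℝ] ℝ)) (ModelProd E (E →L[ℝ] ℝ)) :=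
  𝓘(ℝ, E).prod 𝓘(ℝ, E →L[ℝ] ℝ)

/-- The tautological `1`-form on the cotangent bundle, `θ_p (v) = p (dπ_p v)`. -/
def tautologicalForm (p : CotangentBundle E M) :
    TangentSpace (cotangentModel E) p [⋀^Fin 1]→L[ℝ] ℝ :=
  ContinuousAlternatingMap.ofSubsingleton ℝ (TangentSpace (cotangentModel E) p) ℝ (0 : Fin 1)
    (ContinuousLinearMap.comp (show TangentSpace 𝓘(ℝ, E) p.proj →L[ℝ] ℝ from p.snd)
      (mfderiv (cotangentModel E) 𝓘(ℝ, E) (fun r : CotangentBundle E M ↦ r.proj) p))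

/-- The canonical symplectic form on the cotangent bundle, `α = -dθ`. -/
def canonicalForm (p : CotangentBundle E M) :
    TangentSpace (cotangentModel E) p [⋀^Fin 2]→L[ℝ] ℝ :=
  -extDerivForm (cotangentModel E) (tautologicalForm E M) p

variable {E M}

/-- The function `p_q ↦ p (X_q)` on the cotangent bundle. -/
def hamiltonianFunction (X : (q : M) → TangentSpace 𝓘(ℝ, E) q) (p : CotangentBundle E M) : ℝ :=
  p.snd (X p.proj)

/-- The lift of a diffeomorphism `Φ` of `M` to the cotangent bundle: the covector `p` at `q` goes
to the covector `(Φ⁻¹)^* p = p ∘ d(Φ⁻¹)_{Φ q}` at `Φ q`. (`d(Φ⁻¹)_{Φ q}` has values in the tangent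
space at `Φ⁻¹ (Φ q)`, that is, at `q`.) -/
def liftCotangent (Φ : M ≃ M) (p : CotangentBundle E M) : CotangentBundle E M :=
  ⟨Φ p.proj, ContinuousLinearMap.comp (show TangentSpace 𝓘(ℝ, E) p.proj →L[ℝ] ℝ from p.snd)
    (show TangentSpace 𝓘(ℝ, E) (Φ p.proj) →L[ℝ] TangentSpace 𝓘(ℝ, E) p.proj from
      mfderiv 𝓘(ℝ, E) 𝓘(ℝ, E) Φ.symm (Φ p.proj))⟩

/-- The cotangent lift of a smooth complete vector field `X`: the infinitesimal generator of the
lifts to the cotangent bundle of the maps `φ^t` of the flow of `X`. At `p` it is the velocity at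
`t = 0` of the curve that sends `t` to the lift of `φ^t` applied to `p`. (This curve is at `p` for
`t = 0`, so that its velocity there is a tangent vector at `p`.) -/
def cotangentLift [FiniteDimensional ℝ E] [T2Space M] (X : (q : M) → TangentSpace 𝓘(ℝ, E) q)
    (hXs : IsSmoothVectorField 𝓘(ℝ, E) X)
    (hX : IsCompleteVectorField 𝓘(ℝ, E) X) (p : CotangentBundle E M) :
    TangentSpace (cotangentModel E) p :=
  show TangentSpace (cotangentModel E) p from
    mfderiv 𝓘(ℝ, ℝ) (cotangentModel E)
      (fun t : ℝ ↦ liftCotangent (flowEquiv 𝓘(ℝ, E) X hXs hX t) p) 0 (1 : ℝ)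

end Cotangent

end

/-!
Smooth dependence of the flow on the initial point comes from the implicit function theorem in the
Banach space `C([a, b], E)`, applied to the integral equation `γ - x - s ∫ f ∘ γ = 0` near `s = 0`,
where it is solved by constant curves. Rescaling time turns `s` into the time parameter, and the
group law spreads smoothness from short times to all times.

In cotangent charts `θ = ξ dx`, so `α = dx ∧ dξ` has constant coefficients. If `ξ_t` is the covector
part of the lifted curve, then `ξ_t ∘ Dφ_t` is constant; as the time derivative of `Dφ_t` at `0` is
`DX` by symmetry of mixed partial derivatives, the lifted flow is generated by `(X, -ξ ∘ DX)`.
Contracting `α` with this vector field gives `ξ(DX dx) + dξ(X)`, the differential of `ξ(X)`.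
-/

section CompositionOperator

universe u

variable {K : Type*} [TopologicalSpace K] [CompactSpace K]
  {E : Type u} [NormedAddCommGroup E] [NormedSpace ℝ E]
  {F : Type u} [NormedAddCommGroup F] [NormedSpace ℝ F]

-- A shortcut, as the search for this instance exceeds the default heartbeat limit.
noncomputable local instance : NormedAddCommGroup C(K, E →L[ℝ] F) :=
  ContinuousMap.instNormedAddCommGroup

variable (K E F) in
/-- Pointwise application of a continuous family of operators to a continuous map. The derivative
of the composition operator `γ ↦ f ∘ γ` is of this form. -/
noncomputable def pointwiseApply : C(K, E →L[ℝ] F) →L[ℝ] C(K, E) →L[ℝ] C(K, F) :=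
  LinearMap.mkContinuous₂
    (LinearMap.mk₂ ℝ (fun (A : C(K, E →L[ℝ] F)) (h : C(K, E)) ↦
      (⟨fun k ↦ A k (h k), by fun_prop⟩ : C(K, F)))
      (fun _ _ _ ↦ by ext; simp) (fun _ _ _ ↦ by ext; simp)
      (fun _ _ _ ↦ by ext; simp) (fun _ _ _ ↦ by ext; simp)) 1
    (fun A h ↦ by
      refine (ContinuousMap.norm_le _ (by positivity)).2 fun k ↦ ?_
      rw [one_mul]
      exact (A k).le_of_opNorm_le_of_le (A.norm_coe_le_norm k) (h.norm_coe_le_norm k))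

theorem hasFDerivAt_continuousMap_comp {f : E → F} (hf : ContDiff ℝ 1 f) (γ : C(K, E)) :
    HasFDerivAt (fun γ : C(K, E) ↦ (⟨f, hf.continuous⟩ : C(E, F)).comp γ)
      (pointwiseApply K E F
        ((⟨fderiv ℝ f, hf.continuous_fderiv one_ne_zero⟩ : C(E, E →L[ℝ] F)).comp γ)) γ := by
  rw [hasFDerivAt_iff_isLittleO_nhds_zero, Asymptotics.isLittleO_iff]
  intro c hc
  have hunif := (isCompact_range γ.continuous).uniformContinuousAt_of_continuousAt (fderiv ℝ f)
    (fun x _ ↦ (hf.continuous_fderiv one_ne_zero).continuousAt) (Metric.dist_mem_uniformity hc)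
  obtain ⟨δ, hδ, hball⟩ := Metric.mem_uniformity_dist.1 hunif
  filter_upwards [Metric.ball_mem_nhds (0 : C(K, E)) hδ] with h hh
  rw [mem_ball_zero_iff] at hh
  refine (ContinuousMap.norm_le _ (by positivity)).2 fun k ↦ ?_
  have hderiv : ∀ x ∈ Metric.ball (γ k) δ, ‖fderiv ℝ f x - fderiv ℝ f (γ k)‖ ≤ c := by
    intro x hx
    have := @hball (γ k) x (by rwa [dist_comm]) (mem_range_self k)
    rw [mem_ofPred_eq, dist_comm, dist_eq_norm] at this
    exact this.le
  have hmem : γ k + h k ∈ Metric.ball (γ k) δ := by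
    simpa [dist_eq_norm] using (h.norm_coe_le_norm k).trans_lt hh
  have hmvt := (convex_ball (γ k) δ).norm_image_sub_le_of_norm_fderiv_le' (𝕜 := ℝ)
    (fun x _ ↦ hf.differentiable one_ne_zero x) hderiv (Metric.mem_ball_self hδ) hmem
  rw [add_sub_cancel_left] at hmvt
  exact hmvt.trans (mul_le_mul_of_nonneg_left (h.norm_coe_le_norm k) hc.le)

theorem contDiff_nat_continuousMap_comp (n : ℕ) :
    ∀ (F : Type u) [NormedAddCommGroup F] [NormedSpace ℝ F] (f : C(E, F)), ContDiff ℝ n f →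
      ContDiff ℝ n (fun γ : C(K, E) ↦ f.comp γ) := by
  induction n with
  | zero =>
    intro F _ _ f _
    exact contDiff_zero.2 (ContinuousMap.continuous_postcomp f)
  | succ n ih =>
    intro F _ _ f hf
    have hf₁ : ContDiff ℝ 1 f := hf.of_le (by norm_cast; omega)
    push_cast at hf ⊢
    rw [contDiff_succ_iff_hasFDerivAt]
    refine ⟨_, ?_, fun γ ↦ hasFDerivAt_continuousMap_comp hf₁ γ⟩
    exact (pointwiseApply K E F).contDiff.comp
      (ih (E →L[ℝ] F) ⟨_, hf₁.continuous_fderiv one_ne_zero⟩ (contDiff_succ_iff_fderiv.1 hf).2.2)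

theorem contDiff_continuousMap_comp (f : C(E, F)) (hf : ContDiff ℝ ∞ f) :
    ContDiff ℝ ∞ (fun γ : C(K, E) ↦ f.comp γ) :=
  contDiff_infty.2 fun n ↦ contDiff_nat_continuousMap_comp n F f (contDiff_infty.1 hf n)

end CompositionOperator

section SmoothDependence

variable {E : Type*} [NormedAddCommGroup E] [NormedSpace ℝ E] {a b : ℝ}

/-- The operator that maps a continuous function on `[a, b]` to its primitive that vanishes at the
time `t₀`. The function is extended by constants outside `[a, b]` in order to integrate it over an
interval of real numbers. -/
noncomputable def primitiveCLM (t₀ : Icc a b) : C(Icc a b, E) →L[ℝ] C(Icc a b, E) :=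
  have hab : a ≤ b := t₀.2.1.trans t₀.2.2
  have hcont (γ : C(Icc a b, E)) : Continuous (IccExtend hab γ) := γ.continuous.Icc_extend'
  LinearMap.mkContinuous
    { toFun := fun γ ↦ ⟨fun t ↦ ∫ τ in (t₀ : ℝ)..t, IccExtend hab γ τ,
        (intervalIntegral.continuous_primitive
          (fun _ _ ↦ (hcont γ).intervalIntegrable _ _) t₀).comp continuous_subtype_val⟩
      map_add' := fun γ γ' ↦ by
        ext t
        exact intervalIntegral.integral_add ((hcont γ).intervalIntegrable _ _)
          ((hcont γ').intervalIntegrable _ _)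
      map_smul' := fun c γ ↦ by
        ext t
        exact intervalIntegral.integral_smul c _ } (b - a)
    (fun γ ↦ by
      refine (ContinuousMap.norm_le _ (by have := norm_nonneg γ; nlinarith)).2 fun t ↦ ?_
      refine (intervalIntegral.norm_integral_le_of_norm_le_const
        (C := ‖γ‖) fun τ _ ↦ γ.norm_coe_le_norm _).trans ?_
      rw [mul_comm]
      gcongr
      exact Set.abs_sub_le_of_uIcc_subset_uIcc
        (uIcc_subset_uIcc (by simp [hab]) (by simp [hab])) |>.trans_eq
          (abs_of_nonneg (sub_nonneg.2 hab)))

/-- The residual `γ - x - s ∫ f ∘ γ` of the integral equation of the initial value problem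
`γ' = s • f(γ)`, `γ(t₀) = x`, as a function of `((s, x), γ)`. Unlike the length of the time
interval, the time scale `s` enters it smoothly, and the equation is trivial for `s = 0`. -/
noncomputable def picardResidual (t₀ : Icc a b) (f : C(E, E)) (z : (ℝ × E) × C(Icc a b, E)) :
    C(Icc a b, E) :=
  z.2 - ContinuousMap.const _ z.1.2 - z.1.1 • primitiveCLM t₀ (f.comp z.2)

variable {t₀ : Icc a b} {f : C(E, E)}

theorem contDiff_picardResidual (hf : ContDiff ℝ ∞ f) : ContDiff ℝ ∞ (picardResidual t₀ f) := by
  have hcomp : ContDiff ℝ ∞ (fun z : (ℝ × E) × C(Icc a b, E) ↦ f.comp z.2) :=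
    (contDiff_continuousMap_comp f hf).comp contDiff_snd
  let const : E →L[ℝ] C(Icc a b, E) := ContinuousLinearMap.const ℝ (Icc a b)
  refine (contDiff_snd.sub (const.contDiff.comp (contDiff_snd.comp contDiff_fst))).sub ?_
  exact (contDiff_fst.comp contDiff_fst).smul ((primitiveCLM (E := E) t₀).contDiff.comp hcomp)

theorem picardResidual_zero_const (x : E) :
    picardResidual t₀ f ((0, x), ContinuousMap.const _ x) = 0 := by
  simp [picardResidual]

theorem fderiv_picardResidual_comp_inr (hf : ContDiff ℝ ∞ f) (x : E) (γ : C(Icc a b, E)) :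
    (fderiv ℝ (picardResidual t₀ f) ((0, x), γ)).comp (.inr ℝ (ℝ × E) C(Icc a b, E)) =
      .id ℝ _ := by
  have hpartial : HasFDerivAt (fun γ ↦ picardResidual t₀ f ((0, x), γ)) _ γ :=
    (((contDiff_picardResidual hf).differentiable (by simp)) _).hasFDerivAt.comp γ
      (hasFDerivAt_prodMk_right (0, x) γ)
  refine hpartial.unique ?_
  simp only [picardResidual, zero_smul, sub_zero]
  exact (hasFDerivAt_id γ).sub_const _

theorem eq_const_add_primitive_of_picardResidual_eq_zero {s : ℝ} {x : E} {γ : C(Icc a b, E)}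
    (h : picardResidual t₀ f ((s, x), γ) = 0) (t : Icc a b) :
    γ t = x + s • ∫ τ in (t₀ : ℝ)..t, IccExtend (t₀.2.1.trans t₀.2.2) (f.comp γ) τ := by
  rw [picardResidual, sub_sub, sub_eq_zero] at h
  exact DFunLike.congr_fun h t

theorem hasDerivAt_of_picardResidual_eq_zero [CompleteSpace E] {s : ℝ} {x : E} {γ : C(Icc a b, E)}
    (h : picardResidual t₀ f ((s, x), γ) = 0) (hab : a ≤ b) {t : ℝ} (ht : t ∈ Ioo a b) :
    HasDerivAt (IccExtend hab γ) (s • f (IccExtend hab γ t)) t := by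
  have hcont : Continuous (IccExtend hab (f.comp γ)) := (f.comp γ).continuous.Icc_extend'
  refine (((hcont.integral_hasStrictDerivAt t₀ t).hasDerivAt.const_smul s).const_add
    x).congr_of_eventuallyEq ?_
  filter_upwards [Ioo_mem_nhds ht.1 ht.2] with t ht
  rw [IccExtend_of_mem hab γ (Ioo_subset_Icc_self ht)]
  exact eq_const_add_primitive_of_picardResidual_eq_zero h _

theorem exists_contDiffAt_picardResidual_eq_zero [CompleteSpace E] (hf : ContDiff ℝ ∞ f)
    (t₀ : Icc a b) (x₀ : E) :
    ∃ ψ : ℝ × E → C(Icc a b, E), ContDiffAt ℝ ∞ ψ (0, x₀) ∧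
      ψ (0, x₀) = ContinuousMap.const _ x₀ ∧
      ∀ᶠ z in 𝓝 ((0 : ℝ), x₀), picardResidual t₀ f (z, ψ z) = 0 := by
  let u : (ℝ × E) × C(Icc a b, E) := ((0, x₀), ContinuousMap.const _ x₀)
  have hsmooth : ContDiffAt ℝ ∞ (picardResidual t₀ f) u := (contDiff_picardResidual hf).contDiffAt
  have hinv : ((fderiv ℝ (picardResidual t₀ f) u).comp
      (.inr ℝ (ℝ × E) C(Icc a b, E))).IsInvertible := by
    rw [fderiv_picardResidual_comp_inr hf]
    exact ContinuousLinearMap.isInvertible_equiv (f := .refl ℝ _)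
  refine ⟨hsmooth.implicitFunction (by simp) hinv,
    hsmooth.contDiffAt_implicitFunction (by simp) hinv,
    hsmooth.implicitFunction_apply_self (by simp) hinv, ?_⟩
  filter_upwards [hsmooth.eventually_apply_implicitFunction (by simp) hinv] with z hz
  exact hz.trans (picardResidual_zero_const x₀)

end SmoothDependence

section LocalSolutions

variable {E : Type*} [NormedAddCommGroup E] [NormedSpace ℝ E] [HasContDiffBump E]

theorem exists_contDiff_eventuallyEq_of_contDiffOn {F : Type*} [NormedAddCommGroup F]
    [NormedSpace ℝ F] {f : E → F} {U : Set E} (hf : ContDiffOn ℝ ∞ f U) {x : E} (hU : U ∈ 𝓝 x) :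
    ∃ g : E → F, ContDiff ℝ ∞ g ∧ g =ᶠ[𝓝 x] f := by
  obtain ⟨V, hVU, hV, hxV⟩ := mem_nhds_iff.1 hU
  obtain ⟨ε, hε, hball⟩ := Metric.nhds_basis_closedBall.mem_iff.1 (hV.mem_nhds hxV)
  let b : ContDiffBump x := ⟨ε / 2, ε, by positivity, by linarith⟩
  refine ⟨fun y ↦ b y • f y, contDiff_iff_contDiffAt.2 fun y ↦ ?_, ?_⟩
  · by_cases hy : y ∈ V
    · exact b.contDiffAt.smul (hf.contDiffAt (Filter.mem_of_superset (hV.mem_nhds hy) hVU))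
    · have hy' : y ∉ tsupport b := by
        rw [b.tsupport_eq]
        exact fun h ↦ hy (hball h)
      refine contDiffAt_const (c := (0 : F)) |>.congr_of_eventuallyEq ?_
      filter_upwards [(isClosed_tsupport b).isOpen_compl.mem_nhds hy'] with z hz
      rw [image_eq_zero_of_notMem_tsupport hz, zero_smul]
  · filter_upwards [b.eventuallyEq_one] with y hy
    rw [hy, Pi.one_apply, one_smul]

theorem exists_contDiffAt_solution [CompleteSpace E] {f : E → E} {U : Set E} {x₀ : E}
    (hf : ContDiffOn ℝ ∞ f U) (hU : U ∈ 𝓝 x₀) {a b : ℝ} (h₀ : 0 ∈ Icc a b) :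
    ∃ Γ : ℝ × E → ℝ → E, (∀ t ∈ Icc a b, ContDiffAt ℝ ∞ (fun z ↦ Γ z t) (0, x₀)) ∧
      ∀ᶠ z in 𝓝 ((0 : ℝ), x₀), Γ z 0 = z.2 ∧
        ∀ t ∈ Ioo a b, Γ z t ∈ U ∧ HasDerivAt (Γ z) (z.1 • f (Γ z t)) t := by
  have hab : a ≤ b := h₀.1.trans h₀.2
  obtain ⟨g, hg, hgf⟩ := exists_contDiff_eventuallyEq_of_contDiffOn hf hU
  obtain ⟨ψ, hψ, hψ₀, hψ_eq⟩ := exists_contDiffAt_picardResidual_eq_zero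
    (f := ⟨g, hg.continuous⟩) hg ⟨0, h₀⟩ x₀
  refine ⟨fun z ↦ IccExtend hab (ψ z), fun t _ ↦ ?_, ?_⟩
  · exact (ContinuousMap.evalCLM ℝ (projIcc a b hab t)).contDiff.contDiffAt.comp _ hψ
  have hmem : ∀ᶠ z in 𝓝 ((0 : ℝ), x₀), ∀ t, ψ z t ∈ U ∩ {x | g x = f x} := by
    obtain ⟨ε, hε, hball⟩ := Metric.mem_nhds_iff.1 (Filter.inter_mem hU hgf)
    filter_upwards [hψ.continuousAt.eventually (Metric.ball_mem_nhds _ hε)] with z hz t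
    rw [hψ₀] at hz
    exact hball ((ContinuousMap.dist_apply_le_dist t).trans_lt hz)
  filter_upwards [hψ_eq, hmem] with z hz hzU
  refine ⟨?_, fun t ht ↦ ⟨(hzU _).1, ?_⟩⟩
  · rw [IccExtend_of_mem hab (ψ z) h₀, eq_const_add_primitive_of_picardResidual_eq_zero hz]
    simp
  · exact (hasDerivAt_of_picardResidual_eq_zero hz hab ht).congr_deriv
      (congrArg (z.1 • ·) (hzU _).2)

end LocalSolutions

section Charts

variable {E : Type*} [NormedAddCommGroup E] [NormedSpace ℝ E]
  {H : Type*} [TopologicalSpace H] (I : ModelWithCorners ℝ E H)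
  {N : Type*} [TopologicalSpace N] [ChartedSpace H N]

/-- The derivative at `q` of the preferred chart at `x₀`, as an operator of the model vector space,
to which all tangent spaces are definitionally equal. -/
noncomputable def chartDeriv (x₀ q : N) : E →L[ℝ] E :=
  mfderiv I 𝓘(ℝ, E) (extChartAt I x₀) q

/-- The derivative at `y` of the inverse of the preferred chart at `x₀`, as an operator of the model
vector space. This is the operator in the definition of `formInChart`. -/
noncomputable def chartSymmDeriv (x₀ : N) (y : E) : E →L[ℝ] E :=
  mfderivWithin 𝓘(ℝ, E) I (extChartAt I x₀).symm (range I) y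

/-- The expression of a vector field in the preferred chart at `x₀`: its pushforward by this chart,
a vector field on the model vector space. -/
noncomputable def vectorFieldInChart (X : (q : N) → TangentSpace I q) (x₀ : N) (y : E) : E :=
  chartDeriv I x₀ ((extChartAt I x₀).symm y) (X ((extChartAt I x₀).symm y))

variable {I} {X : (q : N) → TangentSpace I q} {x₀ q : N} {y : E}

theorem vectorFieldInChart_extChartAt (hq : q ∈ (extChartAt I x₀).source) :
    vectorFieldInChart I X x₀ (extChartAt I x₀ q) = chartDeriv I x₀ q (X q) := by
  rw [vectorFieldInChart, (extChartAt I x₀).left_inv hq]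

theorem vectorFieldInChart_const_smul (s : ℝ) :
    vectorFieldInChart I (s • X) x₀ = s • vectorFieldInChart I X x₀ :=
  funext fun _ ↦ map_smul (chartDeriv I x₀ _) s _

variable [IsManifold I 1 N]

theorem chartDeriv_comp_chartSymmDeriv (hq : q ∈ (extChartAt I x₀).source) :
    (chartDeriv I x₀ q).comp (chartSymmDeriv I x₀ (extChartAt I x₀ q)) = .id ℝ E :=
  mfderiv_extChartAt_comp_mfderivWithin_extChartAt_symm' hq

theorem chartSymmDeriv_comp_chartDeriv (hq : q ∈ (extChartAt I x₀).source) :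
    (chartSymmDeriv I x₀ (extChartAt I x₀ q)).comp (chartDeriv I x₀ q) = .id ℝ E :=
  mfderivWithin_extChartAt_symm_comp_mfderiv_extChartAt' hq

theorem chartDeriv_self (q : N) : chartDeriv I q q = .id ℝ E :=
  mfderiv_extChartAt_self

theorem chartSymmDeriv_self (q : N) : chartSymmDeriv I q (extChartAt I q q) = .id ℝ E := by
  rw [← chartDeriv_comp_chartSymmDeriv (mem_extChartAt_source (I := I) q), chartDeriv_self,
    ContinuousLinearMap.id_comp]

theorem vectorFieldInChart_self (q : N) :
    vectorFieldInChart I X q (extChartAt I q q) = X q := by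
  rw [vectorFieldInChart_extChartAt (mem_extChartAt_source q), chartDeriv_self]
  rfl

theorem hasMFDerivAt_extChartAt_symm [I.Boundaryless] (hy : y ∈ (extChartAt I x₀).target) :
    HasMFDerivAt 𝓘(ℝ, E) I (extChartAt I x₀).symm y
      (mfderivWithin 𝓘(ℝ, E) I (extChartAt I x₀).symm (range I) y) := by
  rw [← hasMFDerivWithinAt_univ, ← I.range_eq_univ]
  exact (mdifferentiableWithinAt_extChartAt_symm hy).hasMFDerivWithinAt

theorem hasDerivAt_extChartAt_of_isMIntegralCurve {γ : ℝ → N} (hγ : IsMIntegralCurve γ X) {t : ℝ}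
    (ht : γ t ∈ (extChartAt I x₀).source) :
    HasDerivAt (extChartAt I x₀ ∘ γ) (vectorFieldInChart I X x₀ (extChartAt I x₀ (γ t))) t := by
  have hchart := (mdifferentiableAt_extChartAt (I := I)
    (extChartAt_source I x₀ ▸ ht)).hasMFDerivAt
  have hcomp : HasFDerivAt (extChartAt I x₀ ∘ γ) ((chartDeriv I x₀ (γ t)).comp
      ((1 : ℝ →L[ℝ] ℝ).smulRight (show E from X (γ t)))) t := (hchart.comp t (hγ t)).hasFDerivAt
  rw [vectorFieldInChart_extChartAt ht]
  refine hcomp.hasDerivAt.congr_deriv ?_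
  change chartDeriv I x₀ (γ t) ((1 : ℝ) • X (γ t)) = _
  rw [one_smul]

theorem hasMFDerivAt_extChartAt_symm_comp [I.Boundaryless] {Γ : ℝ → E} {t : ℝ}
    (hΓ : HasDerivAt Γ (vectorFieldInChart I X x₀ (Γ t)) t)
    (ht : Γ t ∈ (extChartAt I x₀).target) :
    HasMFDerivAt 𝓘(ℝ, ℝ) I ((extChartAt I x₀).symm ∘ Γ) t
      ((1 : ℝ →L[ℝ] ℝ).smulRight (X ((extChartAt I x₀).symm (Γ t)))) := by
  refine ((hasMFDerivAt_extChartAt_symm ht).comp t hΓ.hasFDerivAt.hasMFDerivAt).congr_mfderiv ?_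
  have hinv := chartSymmDeriv_comp_chartDeriv ((extChartAt I x₀).map_target ht)
  rw [(extChartAt I x₀).right_inv ht] at hinv
  ext
  change chartSymmDeriv I x₀ (Γ t) ((1 : ℝ) • vectorFieldInChart I X x₀ (Γ t)) =
    (1 : ℝ) • (show E from X ((extChartAt I x₀).symm (Γ t)))
  rw [one_smul, one_smul]
  exact congr($hinv (show E from X ((extChartAt I x₀).symm (Γ t))))

end Charts

section LocalToGlobal

variable {E : Type*} [NormedAddCommGroup E] [NormedSpace ℝ E]
  {H : Type*} [TopologicalSpace H] {I : ModelWithCorners ℝ E H}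
  {N : Type*} [TopologicalSpace N] [ChartedSpace H N] [IsManifold I ∞ N]
  {φ : ℝ → N → N} (hzero : ∀ x, φ 0 x = x) (hadd : ∀ s t x, φ s (φ t x) = φ (s + t) x)
  (hlocal : ∀ y, ContMDiffAt (𝓘(ℝ, ℝ).prod I) I ∞ (fun z : ℝ × N ↦ φ z.1 z.2) (0, y))

include hzero hadd hlocal

theorem eventually_contMDiffAt_flow_iff (n : ℕ) (t : ℝ) (x : N) :
    ∀ᶠ s in 𝓝 t, ContMDiffAt I I n (φ t) x ↔ ContMDiffAt I I n (φ s) x := by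
  have hnhds : ∀ᶠ z in 𝓝 ((0 : ℝ), φ t x), ContMDiffAt I I n (φ z.1) z.2 := by
    filter_upwards [(contMDiffAt_iff_contMDiffAt_nhds (by simp)).1
      (contMDiffAt_infty.1 (hlocal (φ t x)) n)] with z hz
    exact ContMDiffAt.comp (g := fun z : ℝ × N ↦ φ z.1 z.2) z.2 hz
      (contMDiffAt_const.prodMk contMDiffAt_id)
  have hcont : ContinuousAt (fun s ↦ φ (s - t) (φ t x)) t := by
    have : ContinuousAt (fun s ↦ (s - t, φ t x)) t := by fun_prop
    exact (hlocal (φ t x)).continuousAt.comp_of_eq this (by simp)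
  have hforward : ContinuousAt (fun s ↦ (s - t, φ t x)) t := by fun_prop
  have hbackward : ContinuousAt (fun s ↦ (t - s, φ (s - t) (φ t x))) t :=
    ContinuousAt.prodMk (by fun_prop) hcont
  have hnhds₁ := hforward.eventually (p := fun z ↦ ContMDiffAt I I n (φ z.1) z.2)
    (by simpa using hnhds)
  have hnhds₂ := hbackward.eventually (p := fun z ↦ ContMDiffAt I I n (φ z.1) z.2)
    (by simpa [hzero] using hnhds)
  filter_upwards [hnhds₁, hnhds₂] with s hs₁ hs₂
  refine ⟨fun h ↦ (hs₁.comp x h).congr_of_eventuallyEq (.of_forall fun q ↦ ?_),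
    fun h ↦ (ContMDiffAt.comp_of_eq (g := φ (t - s)) hs₂ h ?_).congr_of_eventuallyEq
      (.of_forall fun q ↦ ?_)⟩
  · simp [hadd]
  · simp [hadd]
  · simp [hadd]

theorem contMDiffAt_flow (n : ℕ) (t : ℝ) (x : N) : ContMDiffAt I I n (φ t) x := by
  have h₀ : ContMDiffAt I I n (φ 0) x := contMDiffAt_id.congr_of_eventuallyEq (.of_forall hzero)
  refine PreconnectedSpace.induction₂'
    (fun s t ↦ ContMDiffAt I I n (φ s) x → ContMDiffAt I I n (φ t) x) (fun s ↦ ?_)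
    ⟨fun _ _ _ h h' ↦ h' ∘ h⟩ 0 t h₀
  filter_upwards [eventually_contMDiffAt_flow_iff hzero hadd hlocal n s x] with t ht
  exact ⟨ht.1, ht.2⟩

theorem isSmoothGlobalFlow_of_contMDiffAt_zero : IsSmoothGlobalFlow I φ := by
  refine ⟨contMDiff_infty.2 fun n ⟨t, x⟩ ↦ ?_, hzero, hadd⟩
  have hshift : ContMDiffAt (𝓘(ℝ, ℝ).prod I) (𝓘(ℝ, ℝ).prod I) n
      (fun z : ℝ × N ↦ (z.1 - t, φ t z.2)) (t, x) :=
    (contMDiffAt_fst.sub contMDiffAt_const).prodMk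
      ((contMDiffAt_flow hzero hadd hlocal n t x).comp (t, x) contMDiffAt_snd)
  refine ((contMDiffAt_infty.1 (hlocal (φ t x)) n).comp_of_eq hshift (by simp)
    ).congr_of_eventuallyEq (.of_forall fun z ↦ ?_)
  simp [hadd]

end LocalToGlobal

section FlowOf

variable {E : Type*} [NormedAddCommGroup E] [NormedSpace ℝ E]
  {H : Type*} [TopologicalSpace H] {I : ModelWithCorners ℝ E H}
  {N : Type*} [TopologicalSpace N] [ChartedSpace H N] [IsManifold I ∞ N]

theorem IsSmoothVectorField.contDiffOn_inChart {X : (q : N) → TangentSpace I q}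
    (hX : IsSmoothVectorField I X) (x₀ : N) :
    ContDiffOn ℝ ∞ (vectorFieldInChart I X x₀) (extChartAt I x₀).target := by
  let e := trivializationAt E (TangentSpace I) x₀
  have htriv : ContMDiffOn I 𝓘(ℝ, E) ∞ (fun q ↦ (e ⟨q, X q⟩).2) e.baseSet :=
    (Trivialization.contMDiffOn_section_baseSet_iff _).1 (ContMDiff.contMDiffOn hX)
  have hcomp := htriv.comp (contMDiffOn_extChartAt_symm (I := I) (n := ∞) x₀)
    (fun y hy ↦ by simpa [e] using (extChartAt I x₀).map_target hy)
  refine (contMDiffOn_iff_contDiffOn.1 hcomp).congr fun y hy ↦ ?_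
  have hq : (extChartAt I x₀).symm y ∈ (chartAt H x₀).source := by
    simpa using (extChartAt I x₀).map_target hy
  refine congr($(TangentBundle.continuousLinearMapAt_trivializationAt (I := I) hq)
    (X ((extChartAt I x₀).symm y))).symm.trans ?_
  exact congrFun (Trivialization.coe_linearMapAt_of_mem e hq) _

theorem flowOf_mul_eq_extChartAt_symm [I.Boundaryless] [T2Space N]
    {X : (q : N) → TangentSpace I q} (hXs : IsSmoothVectorField I X)
    (hX : IsCompleteVectorField I X) {x₀ q : N} (hq : q ∈ (extChartAt I x₀).source)
    {s a b : ℝ} {Γ : ℝ → E} (hΓ₀ : Γ 0 = extChartAt I x₀ q) (h₀ : 0 ∈ Ioo a b)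
    (hΓ : ∀ t ∈ Ioo a b, Γ t ∈ (extChartAt I x₀).target ∧
      HasDerivAt Γ (s • vectorFieldInChart I X x₀ (Γ t)) t) {t : ℝ} (ht : t ∈ Ioo a b) :
    flowOf I X hX (s * t) q = (extChartAt I x₀).symm (Γ t) := by
  have hcurve : IsMIntegralCurveOn ((extChartAt I x₀).symm ∘ Γ) (s • X) (Ioo a b) :=
    fun t ht ↦ (hasMFDerivAt_extChartAt_symm_comp
      (by rw [vectorFieldInChart_const_smul]; exact (hΓ t ht).2) (hΓ t ht).1).hasMFDerivWithinAt
  have hflow : IsMIntegralCurve (I := I) _ (s • X) := (isMIntegralCurve_flowOf hX q).comp_mul s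
  have hsX : IsSmoothVectorField I (s • X) := ContMDiff.const_smul_section (a := s) hXs
  have heq := isMIntegralCurveOn_Ioo_eqOn_of_contMDiff_boundaryless h₀
    (ContMDiff.of_le hsX (by simp)) (hflow.isMIntegralCurveOn _) hcurve
    (by simp only [comp_apply, zero_mul, flowOf_zero, hΓ₀, (extChartAt I x₀).left_inv hq]) ht
  simpa [mul_comm] using heq

theorem contMDiffAt_flowOf_zero [I.Boundaryless] [CompleteSpace E] [HasContDiffBump E] [T2Space N]
    {X : (q : N) → TangentSpace I q} (hXs : IsSmoothVectorField I X)
    (hX : IsCompleteVectorField I X) (x₀ : N) :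
    ContMDiffAt (𝓘(ℝ, ℝ).prod I) I ∞ (fun z : ℝ × N ↦ flowOf I X hX z.1 z.2) (0, x₀) := by
  let z₀ : ℝ × N → ℝ × E := fun z ↦ (z.1, extChartAt I x₀ z.2)
  have hz₀ : ContMDiffAt (𝓘(ℝ, ℝ).prod I) 𝓘(ℝ, ℝ × E) ∞ z₀ (0, x₀) :=
    contMDiffAt_fst.prodMk_space (contMDiffAt_extChartAt.comp (0, x₀) contMDiffAt_snd)
  obtain ⟨Γ, hΓ, hsol⟩ := exists_contDiffAt_solution (hXs.contDiffOn_inChart x₀)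
    (extChartAt_target_mem_nhds x₀) (a := -2) (b := 2) (by norm_num)
  have hflow : ∀ᶠ z in 𝓝 ((0 : ℝ), x₀),
      flowOf I X hX z.1 z.2 = (extChartAt I x₀).symm (Γ (z₀ z) 1) := by
    filter_upwards [hz₀.continuousAt.eventually hsol,
      continuousAt_snd.eventually (extChartAt_source_mem_nhds (I := I) x₀)] with z hz hzs
    simpa using flowOf_mul_eq_extChartAt_symm hXs hX hzs hz.1 (by norm_num) hz.2
      (t := 1) (by norm_num)
  refine ContMDiffAt.congr_of_eventuallyEq ?_ hflow
  have hΓ₁ : ContMDiffAt (𝓘(ℝ, ℝ).prod I) 𝓘(ℝ, E) ∞ (fun z ↦ Γ (z₀ z) 1) (0, x₀) :=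
    ContMDiffAt.comp (g := fun z ↦ Γ z 1) (0, x₀) (hΓ 1 (by norm_num)).contMDiffAt hz₀
  have hmem : Γ (z₀ (0, x₀)) 1 ∈ (extChartAt I x₀).target :=
    (hsol.self_of_nhds.2 1 (by norm_num)).1
  exact ((contMDiffOn_extChartAt_symm x₀).contMDiffAt
    ((isOpen_extChartAt_target x₀).mem_nhds hmem)).comp (0, x₀) hΓ₁

theorem IsSmoothVectorField.isSmoothGlobalFlow_flowOf [I.Boundaryless] [FiniteDimensional ℝ E]
    [T2Space N] {X : (q : N) → TangentSpace I q} (hXs : IsSmoothVectorField I X)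
    (hX : IsCompleteVectorField I X) : IsSmoothGlobalFlow I (flowOf I X hX) :=
  have : CompleteSpace E := FiniteDimensional.complete ℝ E
  isSmoothGlobalFlow_of_contMDiffAt_zero (flowOf_zero hX) (flowOf_add hXs hX)
    (contMDiffAt_flowOf_zero hXs hX)

end FlowOf

section Generator

variable {E : Type*} [NormedAddCommGroup E] [NormedSpace ℝ E]
  {H : Type*} [TopologicalSpace H] (I : ModelWithCorners ℝ E H)
  {N : Type*} [TopologicalSpace N] [ChartedSpace H N]

/-- The infinitesimal generator of a flow: the velocity at time `0` of the curve `t ↦ φ t x`. It is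
a tangent vector at `φ 0 x`, regarded as one at `x`, which is harmless if `φ 0 x = x`. -/
noncomputable def flowGenerator (φ : ℝ → N → N) (x : N) : TangentSpace I x :=
  show TangentSpace I x from mfderiv 𝓘(ℝ, ℝ) I (fun t : ℝ ↦ φ t x) 0 (1 : ℝ)

variable {I}

theorem flowGenerator_flowOf {X : (x : N) → TangentSpace I x} (hX : IsCompleteVectorField I X) :
    flowGenerator I (flowOf I X hX) = X := by
  funext x
  have hderiv := congr($((isMIntegralCurve_flowOf hX x 0).mfderiv) (1 : ℝ))
  refine hderiv.trans ?_
  change (1 : ℝ) • (show E from X (flowOf I X hX 0 x)) = _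
  rw [one_smul, flowOf_zero]

namespace IsSmoothGlobalFlow

variable {φ : ℝ → N → N} (hφ : IsSmoothGlobalFlow I φ)
include hφ

theorem contMDiff_curve (x : N) : ContMDiff 𝓘(ℝ, ℝ) I ∞ (fun t : ℝ ↦ φ t x) :=
  hφ.smooth.comp (contMDiff_id.prodMk contMDiff_const)

theorem contMDiff_time (t : ℝ) : ContMDiff I I ∞ (φ t) :=
  hφ.smooth.comp (contMDiff_const.prodMk contMDiff_id)

theorem hasMFDerivAt_curve_zero (x : N) :
    HasMFDerivAt 𝓘(ℝ, ℝ) I (fun t : ℝ ↦ φ t x) 0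
      ((1 : ℝ →L[ℝ] ℝ).smulRight (show E from flowGenerator I φ x)) := by
  refine ((hφ.contMDiff_curve x).mdifferentiableAt (by simp)).hasMFDerivAt.congr_mfderiv ?_
  ext
  exact (one_smul ℝ (show E from flowGenerator I φ x)).symm

theorem isMIntegralCurve (x : N) :
    IsMIntegralCurve (I := I) (fun t ↦ φ t x) (flowGenerator I φ) := by
  intro t
  have hzero := hφ.hasMFDerivAt_curve_zero (φ t x)
  have hsub : HasMFDerivAt 𝓘(ℝ, ℝ) 𝓘(ℝ, ℝ) (fun s : ℝ ↦ s - t) t (.id ℝ ℝ) :=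
    ((hasFDerivAt_id t).sub_const t).hasMFDerivAt
  rw [← sub_self t] at hzero
  have hcomp := HasMFDerivAt.comp (g := fun s ↦ φ s (φ t x)) (f := fun s ↦ s - t) t hzero hsub
  have hshift : (fun s ↦ φ s (φ t x)) ∘ (fun s ↦ s - t) = fun s ↦ φ s x := by
    ext1 s
    simp [hφ.add]
  rwa [hshift] at hcomp

theorem isCompleteVectorField_generator : IsCompleteVectorField I (flowGenerator I φ) :=
  fun x ↦ ⟨fun t ↦ φ t x, hφ.zero x, hφ.isMIntegralCurve x⟩

theorem tangentMap_eq_generator (x : N) :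
    tangentMap (𝓘(ℝ, ℝ).prod I) I (fun z : ℝ × N ↦ φ z.1 z.2) ⟨(0, x), ((1 : ℝ), (0 : E))⟩ =
      ⟨x, flowGenerator I φ x⟩ := by
  have hjoint := (hφ.smooth.mdifferentiableAt (x := ((0 : ℝ), x)) (by simp)).hasMFDerivAt
  have hslice : HasMFDerivAt 𝓘(ℝ, ℝ) (𝓘(ℝ, ℝ).prod I) (fun t : ℝ ↦ (t, x)) 0 _ :=
    (hasMFDerivAt_id (0 : ℝ)).prodMk (hasMFDerivAt_const x (0 : ℝ))
  have hcurve := (HasMFDerivAt.comp (g := fun z : ℝ × N ↦ φ z.1 z.2) 0 hjoint hslice).mfderiv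
  have hbase (a b : N) (hab : a = b) (v : E) :
      (⟨a, v⟩ : TangentBundle I N) = (⟨b, v⟩ : TangentBundle I N) := by subst hab; rfl
  refine Eq.trans ?_ (hbase _ _ (hφ.zero x) _)
  exact congrArg (TotalSpace.mk (φ 0 x)) congr($hcurve (1 : ℝ)).symm

theorem isSmoothVectorField_generator [IsManifold I ∞ N] :
    IsSmoothVectorField I (flowGenerator I φ) := by
  have hsection : ContMDiff I (𝓘(ℝ, ℝ).tangent.prod I.tangent) ∞ (fun x : N ↦
      ((⟨0, (1 : ℝ)⟩, ⟨x, 0⟩) : TangentBundle 𝓘(ℝ, ℝ) ℝ × TangentBundle I N)) :=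
    contMDiff_const.prodMk (contMDiff_zeroSection ℝ (TangentSpace I : N → Type _))
  exact ((hφ.smooth.contMDiff_tangentMap (by simp)).comp
    (contMDiff_equivTangentBundleProd_symm.comp hsection)).congr
      fun x ↦ (hφ.tangentMap_eq_generator x).symm

theorem flowOf_generator [IsManifold I ∞ N] [T2Space N] [BoundarylessManifold I N]
    (h : IsCompleteVectorField I (flowGenerator I φ)) :
    flowOf I (flowGenerator I φ) h = φ := by
  funext t x
  have heq := isMIntegralCurve_Ioo_eq_of_contMDiff_boundaryless (t₀ := (0 : ℝ))
    (ContMDiff.of_le hφ.isSmoothVectorField_generator (by simp)) (isMIntegralCurve_flowOf h x)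
    (hφ.isMIntegralCurve x) (by simp [flowOf_zero, hφ.zero])
  exact congrFun heq t

end IsSmoothGlobalFlow

end Generator

section CotangentCharts

theorem t2Space_totalSpace {B : Type*} [TopologicalSpace B] [T2Space B] (F : Type*)
    [TopologicalSpace F] [T2Space F] (V : B → Type*) [TopologicalSpace (TotalSpace F V)]
    [∀ b, TopologicalSpace (V b)] [FiberBundle F V] : T2Space (TotalSpace F V) := by
  refine ⟨fun p p' hne ↦ ?_⟩
  by_cases hproj : p.proj = p'.proj
  · let e := trivializationAt F V p.proj
    have hp : p ∈ e.source := FiberBundle.mem_trivializationAt_proj_source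
    have hp' : p' ∈ e.source :=
      e.mem_source.2 (hproj ▸ FiberBundle.mem_baseSet_trivializationAt F V p.proj)
    obtain ⟨u, v, hu, hv, hpu, hpv, huv⟩ := t2_separation (e.injOn.ne hp hp' hne)
    refine ⟨_, _, e.continuousOn_toFun.isOpen_inter_preimage e.open_source hu,
      e.continuousOn_toFun.isOpen_inter_preimage e.open_source hv, ⟨hp, hpu⟩, ⟨hp', hpv⟩, ?_⟩
    exact (huv.preimage e).mono inter_subset_right inter_subset_right
  · exact separated_by_continuous (FiberBundle.continuous_proj F V) hproj

variable {E : Type*} [NormedAddCommGroup E] [NormedSpace ℝ E]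
  {M : Type*} [TopologicalSpace M] [ChartedSpace E M]

/-- The covector with base point `q` and value `ξ`, where the cotangent space at `q` is regarded as
the dual of the model vector space. -/
noncomputable def covector (q : M) (ξ : E →L[ℝ] ℝ) : CotangentBundle E M := ⟨q, ξ⟩

/-- The value of a covector, as a functional on the model vector space. -/
noncomputable def covectorValue (p : CotangentBundle E M) : E →L[ℝ] ℝ := p.snd

@[simp]
theorem covector_proj (q : M) (ξ : E →L[ℝ] ℝ) : (covector q ξ).proj = q := rfl

@[simp]
theorem covectorValue_covector (q : M) (ξ : E →L[ℝ] ℝ) : covectorValue (covector q ξ) = ξ := rfl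

theorem covector_ext {p p' : CotangentBundle E M} (hproj : p.proj = p'.proj)
    (hvalue : covectorValue p = covectorValue p') : p = p' := by
  obtain ⟨q, ξ⟩ := p
  obtain ⟨q', ξ'⟩ := p'
  obtain rfl : q = q' := hproj
  exact congrArg (covector (E := E) q) hvalue

variable [IsManifold 𝓘(ℝ, E) ∞ M] {p₀ p : CotangentBundle E M} {z : E × (E →L[ℝ] ℝ)}

theorem mem_extChartAt_cotangent_source :
    p ∈ (extChartAt (cotangentModel E) p₀).source ↔
      p.proj ∈ (extChartAt 𝓘(ℝ, E) p₀.proj).source := by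
  rw [extChartAt_source, extChartAt_source, FiberBundle.chartedSpace_chartAt]
  simp only [mfld_simps]
  refine ⟨fun h ↦ h.1.1, fun h ↦ ⟨⟨h, mem_univ _⟩, ?_⟩⟩
  rwa [Trivialization.coe_fst]
  exact (Trivialization.mem_source _).2 ⟨h, mem_univ _⟩

theorem mem_extChartAt_cotangent_target :
    z ∈ (extChartAt (cotangentModel E) p₀).target ↔
      z.1 ∈ (extChartAt 𝓘(ℝ, E) p₀.proj).target := by
  rw [FiberBundle.extChartAt_target]
  simp only [mem_prod, mem_inter_iff, mem_univ, and_true, mem_preimage, and_iff_left_iff_imp]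
  intro hz
  simpa using (extChartAt 𝓘(ℝ, E) p₀.proj).map_target hz

theorem inCoordinates_covector {q₀ q : M} (ξ : E →L[ℝ] ℝ)
    (hq : q ∈ (extChartAt 𝓘(ℝ, E) q₀).source) :
    ContinuousLinearMap.inCoordinates E (TangentSpace 𝓘(ℝ, E) : M → Type _) ℝ (Trivial M ℝ)
      q₀ q q₀ q ξ = ξ.comp (chartSymmDeriv 𝓘(ℝ, E) q₀ (extChartAt 𝓘(ℝ, E) q₀ q)) := by
  have hsymm : (trivializationAt E (TangentSpace 𝓘(ℝ, E)) q₀).symmL ℝ q =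
      chartSymmDeriv 𝓘(ℝ, E) q₀ (extChartAt 𝓘(ℝ, E) q₀ q) :=
    TangentBundle.symmL_trivializationAt (by simpa using hq)
  rw [← hsymm]
  ext v
  simp only [ContinuousLinearMap.inCoordinates, Trivial.fiberBundle_trivializationAt',
    Trivial.continuousLinearMapAt_trivialization, ContinuousLinearMap.id_comp]
  rfl

theorem extChartAt_cotangent_apply (hp : p.proj ∈ (extChartAt 𝓘(ℝ, E) p₀.proj).source) :
    extChartAt (cotangentModel E) p₀ p = (extChartAt 𝓘(ℝ, E) p₀.proj p.proj,
      (covectorValue p).comp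
        (chartSymmDeriv 𝓘(ℝ, E) p₀.proj (extChartAt 𝓘(ℝ, E) p₀.proj p.proj))) := by
  rw [FiberBundle.extChartAt, ← inCoordinates_covector _ hp]
  rfl

theorem extChartAt_cotangent_symm_apply (hz : z.1 ∈ (extChartAt 𝓘(ℝ, E) p₀.proj).target) :
    (extChartAt (cotangentModel E) p₀).symm z = covector ((extChartAt 𝓘(ℝ, E) p₀.proj).symm z.1)
      (z.2.comp (chartDeriv 𝓘(ℝ, E) p₀.proj ((extChartAt 𝓘(ℝ, E) p₀.proj).symm z.1))) := by
  set q := (extChartAt 𝓘(ℝ, E) p₀.proj).symm z.1 with hq_def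
  have hq : q ∈ (extChartAt 𝓘(ℝ, E) p₀.proj).source :=
    (extChartAt 𝓘(ℝ, E) p₀.proj).map_target hz
  have hchart : extChartAt (cotangentModel E) p₀
      (covector q (z.2.comp (chartDeriv 𝓘(ℝ, E) p₀.proj q))) = z := by
    rw [extChartAt_cotangent_apply hq, covectorValue_covector, covector_proj,
      ContinuousLinearMap.comp_assoc, chartDeriv_comp_chartSymmDeriv hq,
      ContinuousLinearMap.comp_id, hq_def, (extChartAt 𝓘(ℝ, E) p₀.proj).right_inv hz]
  rw [← hchart]
  rw [(extChartAt (cotangentModel E) p₀).left_inv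
    ((mem_extChartAt_cotangent_source (p := covector q _)).2 hq), hchart]

variable {E' : Type*} [NormedAddCommGroup E'] [NormedSpace ℝ E']
  {H' : Type*} [TopologicalSpace H'] {J : ModelWithCorners ℝ E' H'}
  {N : Type*} [TopologicalSpace N] [ChartedSpace H' N] {z₀ : N}

theorem contMDiffAt_cotangent_iff {f : N → CotangentBundle E M} :
    ContMDiffAt J (cotangentModel E) ∞ f z₀ ↔
      ContMDiffAt J 𝓘(ℝ, E) ∞ (fun z ↦ (f z).proj) z₀ ∧
      ContMDiffAt J 𝓘(ℝ, E →L[ℝ] ℝ) ∞ (fun z ↦ (covectorValue (f z)).comp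
        (chartSymmDeriv 𝓘(ℝ, E) (f z₀).proj
          (extChartAt 𝓘(ℝ, E) (f z₀).proj (f z).proj))) z₀ := by
  rw [contMDiffAt_hom_bundle]
  refine and_congr_right fun hproj ↦ Filter.EventuallyEq.contMDiffAt_iff ?_
  filter_upwards [hproj.continuousAt.eventually
    (extChartAt_source_mem_nhds (I := 𝓘(ℝ, E)) (f z₀).proj)] with z hz
  exact inCoordinates_covector _ hz

theorem contMDiffAt_covector_comp_mfderiv [IsManifold J 1 N]
    {F : Type*} [NormedAddCommGroup F] [NormedSpace ℝ F]
    {P : Type*} [TopologicalSpace P] [ChartedSpace F P] [IsManifold 𝓘(ℝ, F) ∞ P]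
    {f : N → M → P} {g : N → M} {p : N → CotangentBundle F P}
    (hf : ContMDiffAt (J.prod 𝓘(ℝ, E)) 𝓘(ℝ, F) ∞ (uncurry f) (z₀, g z₀))
    (hg : ContMDiffAt J 𝓘(ℝ, E) ∞ g z₀) (hp : ContMDiffAt J (cotangentModel F) ∞ p z₀)
    (hproj : ∀ z, f z (g z) = (p z).proj) :
    ContMDiffAt J (cotangentModel E) ∞ (fun z ↦ covector (g z)
      ((covectorValue (p z)).comp (mfderiv 𝓘(ℝ, E) 𝓘(ℝ, F) (f z) (g z)))) z₀ := by
  rw [contMDiffAt_cotangent_iff]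
  refine ⟨hg, ?_⟩
  obtain ⟨hbase, hvalue⟩ := contMDiffAt_cotangent_iff.1 hp
  refine (hvalue.clm_comp (hf.mfderiv (m := ∞) f g hg (by simp))).congr_of_eventuallyEq ?_
  filter_upwards [hg.continuousAt.eventually (extChartAt_source_mem_nhds (I := 𝓘(ℝ, E)) (g z₀)),
    hbase.continuousAt.eventually
      (extChartAt_source_mem_nhds (I := 𝓘(ℝ, F)) (p z₀).proj)] with z hz hz'
  have hinv := chartSymmDeriv_comp_chartDeriv hz'
  rw [← hproj, ← hproj] at hz' hinv
  rw [extChartAt_source] at hz hz'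
  have hcoord := inTangentCoordinates_eq_mfderiv_comp (I := 𝓘(ℝ, E)) (I' := 𝓘(ℝ, F))
    (ϕ := fun z ↦ mfderiv 𝓘(ℝ, E) 𝓘(ℝ, F) (f z) (g z)) (f := g) (g := fun z ↦ f z (g z)) hz hz'
  simp only [hcoord, covectorValue_covector, covector_proj, ← hproj]
  ext v
  exact congr(covectorValue (p z) ($hinv (mfderiv 𝓘(ℝ, E) 𝓘(ℝ, F) (f z) (g z)
    (chartSymmDeriv 𝓘(ℝ, E) (g z₀) (extChartAt 𝓘(ℝ, E) (g z₀) (g z)) v)))).symm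

end CotangentCharts

section CotangentFlow

variable {E : Type*} [NormedAddCommGroup E] [NormedSpace ℝ E]
  {M : Type*} [TopologicalSpace M] [ChartedSpace E M]

/-- The derivative at `q` of the time-`t` map of a flow, as an operator of the model vector
space. -/
noncomputable def flowDeriv (φ : ℝ → M → M) (t : ℝ) (q : M) : E →L[ℝ] E :=
  mfderiv 𝓘(ℝ, E) 𝓘(ℝ, E) (φ t) q

/-- The lift of a flow to the cotangent bundle: the covector `p` at `q` goes at time `t` to
`p ∘ d(φ⁻ᵗ)` at `φᵗ q`, the image of `p` under the lift of the diffeomorphism `φᵗ`. -/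
noncomputable def cotangentFlow (φ : ℝ → M → M) (t : ℝ) (p : CotangentBundle E M) :
    CotangentBundle E M :=
  covector (φ t p.proj) ((covectorValue p).comp (flowDeriv φ (-t) (φ t p.proj)))

namespace IsSmoothGlobalFlow

variable {φ : ℝ → M → M} (hφ : IsSmoothGlobalFlow 𝓘(ℝ, E) φ)
include hφ

theorem hasMFDerivAt_time (t : ℝ) (q : M) :
    HasMFDerivAt 𝓘(ℝ, E) 𝓘(ℝ, E) (φ t) q (flowDeriv (E := E) φ t q) :=
  ((hφ.contMDiff_time t).mdifferentiableAt (by simp)).hasMFDerivAt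

theorem flowDeriv_zero (q : M) : flowDeriv (E := E) φ 0 q = .id ℝ E := by
  have hderiv := hφ.hasMFDerivAt_time 0 q
  rw [show φ 0 = id from funext hφ.zero] at hderiv
  exact hasMFDerivAt_unique hderiv (hasMFDerivAt_id q)

theorem flowDeriv_add (s t : ℝ) (q : M) :
    flowDeriv (E := E) φ (s + t) q = (flowDeriv φ s (φ t q)).comp (flowDeriv φ t q) := by
  have hcomp := (hφ.hasMFDerivAt_time s (φ t q)).comp q (hφ.hasMFDerivAt_time t q)
  rw [show φ s ∘ φ t = φ (s + t) from funext fun x ↦ hφ.add s t x] at hcomp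
  exact hcomp.mfderiv

theorem neg_apply_apply (t : ℝ) (q : M) : φ (-t) (φ t q) = q := by
  rw [hφ.add, neg_add_cancel, hφ.zero]

variable [IsManifold 𝓘(ℝ, E) ∞ M]

theorem contMDiff_cotangentFlow :
    ContMDiff (𝓘(ℝ, ℝ).prod (cotangentModel E)) (cotangentModel E) ∞
      (fun z : ℝ × CotangentBundle E M ↦ cotangentFlow φ z.1 z.2) := by
  have hproj : ContMDiff (𝓘(ℝ, ℝ).prod (cotangentModel E)) 𝓘(ℝ, E) ∞
      (fun z : ℝ × CotangentBundle E M ↦ z.2.proj) :=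
    (contMDiff_proj (fun x : M ↦ TangentSpace 𝓘(ℝ, E) x →L[ℝ] Trivial M ℝ x)).comp contMDiff_snd
  have hbackward : ContMDiff ((𝓘(ℝ, ℝ).prod (cotangentModel E)).prod 𝓘(ℝ, E)) 𝓘(ℝ, E) ∞
      (fun w : (ℝ × CotangentBundle E M) × M ↦ φ (-w.1.1) w.2) :=
    hφ.smooth.comp ((contMDiff_fst.comp contMDiff_fst).neg.prodMk contMDiff_snd)
  intro z
  exact contMDiffAt_covector_comp_mfderiv (f := fun z q ↦ φ (-z.1) q) (p := Prod.snd)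
    hbackward.contMDiffAt (hφ.smooth.comp (contMDiff_fst.prodMk hproj)).contMDiffAt
    contMDiffAt_snd fun z ↦ hφ.neg_apply_apply z.1 z.2.proj

theorem isSmoothGlobalFlow_cotangentFlow :
    IsSmoothGlobalFlow (cotangentModel E) (cotangentFlow (E := E) φ) := by
  refine ⟨hφ.contMDiff_cotangentFlow, fun p ↦ covector_ext (hφ.zero p.proj) ?_,
    fun s t p ↦ covector_ext (hφ.add s t p.proj) ?_⟩
  · simp only [cotangentFlow, covectorValue_covector]
    rw [neg_zero, hφ.flowDeriv_zero, ContinuousLinearMap.comp_id]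
  · simp only [cotangentFlow, covectorValue_covector, covector_proj]
    rw [ContinuousLinearMap.comp_assoc, neg_add_rev, hφ.flowDeriv_add, hφ.add s t, hφ.add (-s),
      neg_add_cancel_left]

end IsSmoothGlobalFlow

theorem liftCotangent_flowEquiv [IsManifold 𝓘(ℝ, E) ∞ M] [FiniteDimensional ℝ E] [T2Space M]
    {X : (q : M) → TangentSpace 𝓘(ℝ, E) q}
    (hXs : IsSmoothVectorField 𝓘(ℝ, E) X) (hX : IsCompleteVectorField 𝓘(ℝ, E) X) (t : ℝ)
    (p : CotangentBundle E M) :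
    liftCotangent (flowEquiv 𝓘(ℝ, E) X hXs hX t) p =
      cotangentFlow (flowOf 𝓘(ℝ, E) X hX) t p :=
  rfl

theorem cotangentLift_eq_flowGenerator [IsManifold 𝓘(ℝ, E) ∞ M] [FiniteDimensional ℝ E]
    [T2Space M] {X : (q : M) → TangentSpace 𝓘(ℝ, E) q}
    (hXs : IsSmoothVectorField 𝓘(ℝ, E) X) (hX : IsCompleteVectorField 𝓘(ℝ, E) X) :
    cotangentLift X hXs hX =
      flowGenerator (cotangentModel E) (cotangentFlow (flowOf 𝓘(ℝ, E) X hX)) :=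
  rfl

end CotangentFlow

section FormsInCharts

variable {E : Type*} [NormedAddCommGroup E] [NormedSpace ℝ E]
  {H : Type*} [TopologicalSpace H] {I : ModelWithCorners ℝ E H}
  {N : Type*} [TopologicalSpace N] [ChartedSpace H N]
  {k : ℕ} {α : (x : N) → TangentSpace I x [⋀^Fin k]→L[ℝ] ℝ} {x₀ x₁ : N} {y : E}

/-- The value at a point of a differential form, as a form on the model vector space. -/
def formValue (α : (x : N) → TangentSpace I x [⋀^Fin k]→L[ℝ] ℝ) (x : N) : E [⋀^Fin k]→L[ℝ] ℝ :=
  α x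

theorem formInChart_eq_comp_chartSymmDeriv :
    formInChart I α x₀ y = (formValue α ((extChartAt I x₀).symm y)).compContinuousLinearMap
      (chartSymmDeriv I x₀ y) :=
  rfl

theorem formInChart_self [IsManifold I 1 N] (x : N) :
    formInChart I α x (extChartAt I x x) = formValue α x := by
  rw [formInChart_eq_comp_chartSymmDeriv, extChartAt_to_inv, chartSymmDeriv_self]
  rfl

variable [I.Boundaryless] [IsManifold I ∞ N]

theorem contDiffAt_extChartAt_coordChange (hy : y ∈ (extChartAt I x₀).target)
    (hy' : (extChartAt I x₀).symm y ∈ (extChartAt I x₁).source) :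
    ContDiffAt ℝ ∞ (extChartAt I x₁ ∘ (extChartAt I x₀).symm) y := by
  rw [← contDiffWithinAt_univ, ← I.range_eq_univ]
  exact contDiffWithinAt_ext_coord_change x₁ x₀
    (by simpa using! ⟨by simpa using hy, by simpa using! hy'⟩)

theorem chartSymmDeriv_eq_comp_fderiv_coordChange (hy : y ∈ (extChartAt I x₀).target)
    (hy' : (extChartAt I x₀).symm y ∈ (extChartAt I x₁).source) :
    chartSymmDeriv I x₀ y =
      (chartSymmDeriv I x₁ (extChartAt I x₁ ((extChartAt I x₀).symm y))).comp
        (fderiv ℝ (extChartAt I x₁ ∘ (extChartAt I x₀).symm) y) := by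
  have hchange : HasMFDerivAt 𝓘(ℝ, E) 𝓘(ℝ, E) (extChartAt I x₁ ∘ (extChartAt I x₀).symm) y
      (fderiv ℝ (extChartAt I x₁ ∘ (extChartAt I x₀).symm) y) :=
    ((contDiffAt_extChartAt_coordChange hy hy').differentiableAt
      (by simp)).hasFDerivAt.hasMFDerivAt
  have hcomp := (hasMFDerivAt_extChartAt_symm ((extChartAt I x₁).map_source hy')).comp y hchange
  refine hasMFDerivAt_unique (hasMFDerivAt_extChartAt_symm hy) (hcomp.congr_of_eventuallyEq ?_)
  filter_upwards [(continuousAt_extChartAt_symm'' hy).eventually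
    (extChartAt_source_mem_nhds' hy')] with z hz
  exact ((extChartAt I x₁).left_inv hz).symm

theorem formInChart_eq_pullback_coordChange (hy : y ∈ (extChartAt I x₀).target)
    (hy' : (extChartAt I x₀).symm y ∈ (extChartAt I x₁).source) :
    formInChart I α x₀ y =
      (formInChart I α x₁ ((extChartAt I x₁ ∘ (extChartAt I x₀).symm) y)).compContinuousLinearMap
        (fderiv ℝ (extChartAt I x₁ ∘ (extChartAt I x₀).symm) y) := by
  rw [formInChart_eq_comp_chartSymmDeriv, formInChart_eq_comp_chartSymmDeriv, comp_apply,
    (extChartAt I x₁).left_inv hy', chartSymmDeriv_eq_comp_fderiv_coordChange hy hy']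
  rfl

theorem formValue_extDerivForm (x : N) :
    formValue (extDerivForm I α) x = extDeriv (formInChart I α x) (extChartAt I x x) := by
  have hpullback : formValue (extDerivForm I α) x =
      (extDeriv (formInChart I α x) (extChartAt I x x)).compContinuousLinearMap
        (chartDeriv I x x) := by
    rw [← extDerivWithin_univ, ← I.range_eq_univ]
    rfl
  rw [hpullback, chartDeriv_self]
  rfl

theorem formInChart_extDerivForm (hα : IsSmoothForm I α) (hy : y ∈ (extChartAt I x₀).target) :
    formInChart I (extDerivForm I α) x₀ y = extDeriv (formInChart I α x₀) y := by
  set x := (extChartAt I x₀).symm y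
  set T := extChartAt I x ∘ (extChartAt I x₀).symm
  have hx : (extChartAt I x₀).symm y ∈ (extChartAt I x).source := mem_extChartAt_source x
  have hpullback : formInChart I α x₀ =ᶠ[𝓝 y] fun z ↦
      (formInChart I α x (T z)).compContinuousLinearMap (fderiv ℝ T z) := by
    filter_upwards [(continuousAt_extChartAt_symm'' hy).eventually
      (extChartAt_source_mem_nhds' hx), (isOpen_extChartAt_target x₀).mem_nhds hy] with z hz hz'
    exact formInChart_eq_pullback_coordChange hz' hz
  have hdiff : DifferentiableAt ℝ (formInChart I α x) (T y) :=
    ((hα x).contDiffAt ((isOpen_extChartAt_target x).mem_nhds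
      ((extChartAt I x).map_source hx))).differentiableAt (by simp)
  have hfderiv : chartSymmDeriv I x₀ y = fderiv ℝ T y := by
    rw [chartSymmDeriv_eq_comp_fderiv_coordChange hy hx, chartSymmDeriv_self,
      ContinuousLinearMap.id_comp]
  rw [hpullback.extDeriv_eq, extDeriv_pullback hdiff (contDiffAt_extChartAt_coordChange hy hx)
    (r := ∞) (by simpa using WithTop.coe_le_coe.2 (le_top : (2 : ℕ∞) ≤ ⊤)), ← hfderiv,
    formInChart_eq_comp_chartSymmDeriv, formValue_extDerivForm]
  rfl

end FormsInCharts

section ModelCanonicalForm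

theorem extDeriv_const {V W : Type*} [NormedAddCommGroup V] [NormedSpace ℝ V]
    [NormedAddCommGroup W] [NormedSpace ℝ W] {k : ℕ} (α : V [⋀^Fin k]→L[ℝ] W) (x : V) :
    extDeriv (fun _ ↦ α) x = 0 := by
  ext v
  simp [extDeriv_apply (differentiableAt_const α)]

theorem exists_forall_apply_eq_of_finiteDimensional {E : Type*} [NormedAddCommGroup E]
    [NormedSpace ℝ E] [FiniteDimensional ℝ E] (Λ : (E →L[ℝ] ℝ) →L[ℝ] ℝ) :
    ∃ u : E, ∀ η : E →L[ℝ] ℝ, η u = Λ η := by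
  let Λ' : Module.Dual ℝ (Module.Dual ℝ E) :=
    Λ.toLinearMap.comp (LinearMap.toContinuousLinearMap (𝕜 := ℝ) (E := E) (F' := ℝ)).toLinearMap
  exact ⟨(Module.evalEquiv ℝ E).symm Λ', fun η ↦
    Module.apply_evalEquiv_symm_apply (R := ℝ) (M := E) η.toLinearMap Λ'⟩

variable (E : Type*) [NormedAddCommGroup E] [NormedSpace ℝ E]

/-- The tautological form `ξ dx` of `E × E*`, the expression in charts of the tautological form of a
cotangent bundle. -/
noncomputable def modelTautologicalForm :
    E × (E →L[ℝ] ℝ) → (E × (E →L[ℝ] ℝ)) [⋀^Fin 1]→L[ℝ] ℝ := fun z ↦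
  ContinuousAlternatingMap.ofSubsingleton ℝ (E × (E →L[ℝ] ℝ)) ℝ (0 : Fin 1)
    (z.2.comp (ContinuousLinearMap.fst ℝ E (E →L[ℝ] ℝ)))

theorem modelTautologicalForm_apply (z : E × (E →L[ℝ] ℝ)) (v : Fin 1 → E × (E →L[ℝ] ℝ)) :
    modelTautologicalForm E z v = z.2 (v 0).1 :=
  rfl

theorem contDiff_modelTautologicalForm {n : WithTop ℕ∞} :
    ContDiff ℝ n (modelTautologicalForm E) := by
  have hcomp : ContDiff ℝ n (fun z : E × (E →L[ℝ] ℝ) ↦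
      z.2.comp (ContinuousLinearMap.fst ℝ E (E →L[ℝ] ℝ))) := contDiff_snd.clm_comp contDiff_const
  exact (ContinuousAlternatingMap.ofSubsingletonLIE (𝕜 := ℝ) (0 : Fin 1)).contDiff.comp hcomp

theorem extDeriv_modelTautologicalForm_apply (z a b : E × (E →L[ℝ] ℝ)) :
    extDeriv (modelTautologicalForm E) z ![a, b] = a.2 b.1 - b.2 a.1 := by
  have hfderiv (u : E) : fderiv ℝ (fun z : E × (E →L[ℝ] ℝ) ↦ z.2 u) z =
      (ContinuousLinearMap.apply ℝ ℝ u).comp (ContinuousLinearMap.snd ℝ E (E →L[ℝ] ℝ)) :=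
    ((ContinuousLinearMap.apply ℝ ℝ u).comp
      (ContinuousLinearMap.snd ℝ E (E →L[ℝ] ℝ))).hasFDerivAt.fderiv
  rw [extDeriv_apply ((contDiff_modelTautologicalForm E (n := 1)).differentiable (by simp) z)]
  simp [Fin.sum_univ_two, modelTautologicalForm_apply, hfderiv, Fin.removeNth, sub_eq_add_neg]

/-- The canonical symplectic form of `E × E*`. Since the tautological form is linear in the base
point, its exterior derivative is constant, and it is enough to take its value at `0`. -/
noncomputable def modelCanonicalForm : (E × (E →L[ℝ] ℝ)) [⋀^Fin 2]→L[ℝ] ℝ :=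
  -extDeriv (modelTautologicalForm E) 0

theorem modelCanonicalForm_apply (a b : E × (E →L[ℝ] ℝ)) :
    modelCanonicalForm E ![a, b] = b.2 a.1 - a.2 b.1 := by
  rw [modelCanonicalForm, ContinuousAlternatingMap.neg_apply,
    extDeriv_modelTautologicalForm_apply, neg_sub]

theorem neg_extDeriv_modelTautologicalForm (z : E × (E →L[ℝ] ℝ)) :
    -extDeriv (modelTautologicalForm E) z = modelCanonicalForm E := by
  ext v
  rw [← FinVec.etaExpand_eq v]
  simp only [FinVec.etaExpand, FinVec.map, FinVec.seq]
  exact (congrArg Neg.neg (extDeriv_modelTautologicalForm_apply E z _ _)).trans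
    ((neg_sub _ _).trans (modelCanonicalForm_apply E _ _).symm)

theorem existsUnique_modelCanonicalForm_eq [FiniteDimensional ℝ E]
    (l : (E × (E →L[ℝ] ℝ)) →L[ℝ] ℝ) : ∃! a, ∀ b, modelCanonicalForm E ![a, b] = l b := by
  have hsplit (b : E × (E →L[ℝ] ℝ)) : l b = l (b.1, 0) + l (0, b.2) := by
    rw [← map_add, Prod.mk_add_mk, add_zero, zero_add]
  obtain ⟨u, hu⟩ := exists_forall_apply_eq_of_finiteDimensional
    (l.comp (ContinuousLinearMap.inr ℝ E (E →L[ℝ] ℝ)))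
  have hu' (η : E →L[ℝ] ℝ) : η u = l (0, η) := hu η
  simp only [modelCanonicalForm_apply]
  refine ⟨(u, -l.comp (ContinuousLinearMap.inl ℝ E (E →L[ℝ] ℝ))), fun b ↦ ?_, fun a ha ↦
    Prod.ext ?_ (ContinuousLinearMap.ext fun x ↦ ?_)⟩
  · simp [hsplit b, hu', add_comm]
  · refine (SeparatingDual.eq_iff_forall_dual_eq (R := ℝ)).2 fun η ↦ ?_
    simpa [hu'] using ha (0, η)
  · simpa [neg_eq_iff_eq_neg] using ha (x, 0)

end ModelCanonicalForm

section CanonicalForm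

variable (E : Type*) [NormedAddCommGroup E] [NormedSpace ℝ E]
  (M : Type*) [TopologicalSpace M] [ChartedSpace E M] [IsManifold 𝓘(ℝ, E) ∞ M]
  {p₀ : CotangentBundle E M} {z : E × (E →L[ℝ] ℝ)}

theorem mfderiv_proj_comp_chartSymmDeriv (hz : z ∈ (extChartAt (cotangentModel E) p₀).target) :
    (show E × (E →L[ℝ] ℝ) →L[ℝ] E from mfderiv (cotangentModel E) 𝓘(ℝ, E)
      (fun r : CotangentBundle E M ↦ r.proj) ((extChartAt (cotangentModel E) p₀).symm z)).comp
        (chartSymmDeriv (cotangentModel E) p₀ z) =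
      (chartSymmDeriv 𝓘(ℝ, E) p₀.proj z.1).comp (ContinuousLinearMap.fst ℝ E (E →L[ℝ] ℝ)) := by
  have hproj : MDifferentiableAt (cotangentModel E) 𝓘(ℝ, E)
      (fun r : CotangentBundle E M ↦ r.proj) ((extChartAt (cotangentModel E) p₀).symm z) :=
    (contMDiff_proj (n := ∞) (IB := 𝓘(ℝ, E)) (F := E →L[ℝ] ℝ)
      (fun x : M ↦ TangentSpace 𝓘(ℝ, E) x →L[ℝ] Trivial M ℝ x)).mdifferentiableAt (by simp)
  have hleft := HasMFDerivAt.comp (g := fun r : CotangentBundle E M ↦ r.proj) z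
    hproj.hasMFDerivAt (hasMFDerivAt_extChartAt_symm hz)
  have hright := (hasMFDerivAt_extChartAt_symm (mem_extChartAt_cotangent_target.1 hz)).comp z
    (hasFDerivAt_fst (𝕜 := ℝ) (E := E) (F := E →L[ℝ] ℝ) (p := z)).hasMFDerivAt
  refine hasMFDerivAt_unique hleft (hright.congr_of_eventuallyEq ?_)
  filter_upwards [(isOpen_extChartAt_target p₀).mem_nhds hz] with w hw
  rw [comp_apply, comp_apply,
    extChartAt_cotangent_symm_apply (mem_extChartAt_cotangent_target.1 hw), covector_proj]

theorem formInChart_tautologicalForm (hz : z ∈ (extChartAt (cotangentModel E) p₀).target) :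
    formInChart (cotangentModel E) (tautologicalForm E M) p₀ z = modelTautologicalForm E z := by
  have hz' := mem_extChartAt_cotangent_target.1 hz
  have hinv := chartDeriv_comp_chartSymmDeriv ((extChartAt 𝓘(ℝ, E) p₀.proj).map_target hz')
  rw [(extChartAt 𝓘(ℝ, E) p₀.proj).right_inv hz'] at hinv
  ext v
  refine (congr(covectorValue ((extChartAt (cotangentModel E) p₀).symm z)
    ($(mfderiv_proj_comp_chartSymmDeriv E M hz) (v 0)))).trans ?_
  rw [extChartAt_cotangent_symm_apply hz', covectorValue_covector]
  exact congr(z.2 ($hinv (v 0).1))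

theorem isSmoothForm_tautologicalForm :
    IsSmoothForm (cotangentModel E) (tautologicalForm E M) := fun _ ↦
  (contDiff_modelTautologicalForm E).contDiffOn.congr fun _ hz ↦
    formInChart_tautologicalForm E M hz

theorem formInChart_canonicalForm (hz : z ∈ (extChartAt (cotangentModel E) p₀).target) :
    formInChart (cotangentModel E) (canonicalForm E M) p₀ z = modelCanonicalForm E := by
  have htaut : formInChart (cotangentModel E) (tautologicalForm E M) p₀ =ᶠ[𝓝 z]
      modelTautologicalForm E := by
    filter_upwards [(isOpen_extChartAt_target p₀).mem_nhds hz] with w hw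
    exact formInChart_tautologicalForm E M hw
  change -formInChart (cotangentModel E)
    (extDerivForm (cotangentModel E) (tautologicalForm E M)) p₀ z = _
  rw [formInChart_extDerivForm (isSmoothForm_tautologicalForm E M) hz, htaut.extDeriv_eq,
    neg_extDeriv_modelTautologicalForm]

theorem formValue_canonicalForm (p : CotangentBundle E M) :
    formValue (canonicalForm E M) p = modelCanonicalForm E := by
  rw [← formInChart_self, formInChart_canonicalForm E M (mem_extChartAt_target p)]

theorem isSymplecticForm_canonicalForm [FiniteDimensional ℝ E] :
    IsSymplecticForm (cotangentModel E) (canonicalForm E M) where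
  smooth _ := contDiffOn_const.congr fun _ hz ↦ formInChart_canonicalForm E M hz
  closed p := by
    have hconst : formInChart (cotangentModel E) (canonicalForm E M) p
        =ᶠ[𝓝 (extChartAt (cotangentModel E) p p)] fun _ ↦ modelCanonicalForm E := by
      filter_upwards [extChartAt_target_mem_nhds p] with w hw
      exact formInChart_canonicalForm E M hw
    change formValue (extDerivForm (cotangentModel E) (canonicalForm E M)) p = 0
    rw [formValue_extDerivForm, hconst.extDeriv_eq, extDeriv_const]
  nondegenerate p l := by
    have hmodel := existsUnique_modelCanonicalForm_eq E l
    rwa [← formValue_canonicalForm E M p] at hmodel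

end CanonicalForm

section Hamiltonian

variable {E : Type*} [NormedAddCommGroup E] [NormedSpace ℝ E]
  {M : Type*} [TopologicalSpace M] [ChartedSpace E M] [IsManifold 𝓘(ℝ, E) ∞ M]
  {X : (q : M) → TangentSpace 𝓘(ℝ, E) q}

theorem extChartAt_cotangent_self (p : CotangentBundle E M) :
    extChartAt (cotangentModel E) p p = (extChartAt 𝓘(ℝ, E) p.proj p.proj, covectorValue p) := by
  rw [extChartAt_cotangent_apply (mem_extChartAt_source p.proj), chartSymmDeriv_self,
    ContinuousLinearMap.comp_id]

theorem hamiltonianFunction_extChartAt_symm (X : (q : M) → TangentSpace 𝓘(ℝ, E) q)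
    {p₀ : CotangentBundle E M} {z : E × (E →L[ℝ] ℝ)}
    (hz : z ∈ (extChartAt (cotangentModel E) p₀).target) :
    hamiltonianFunction X ((extChartAt (cotangentModel E) p₀).symm z) =
      z.2 (vectorFieldInChart 𝓘(ℝ, E) X p₀.proj z.1) := by
  rw [extChartAt_cotangent_symm_apply (mem_extChartAt_cotangent_target.1 hz)]
  rfl

theorem contMDiff_hamiltonianFunction (hX : IsSmoothVectorField 𝓘(ℝ, E) X) :
    ContMDiff (cotangentModel E) 𝓘(ℝ, ℝ) ∞ (hamiltonianFunction X) := by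
  intro p₀
  have hchart : ContDiffOn ℝ ∞
      (fun z : E × (E →L[ℝ] ℝ) ↦ z.2 (vectorFieldInChart 𝓘(ℝ, E) X p₀.proj z.1))
      (extChartAt (cotangentModel E) p₀).target :=
    contDiffOn_snd.clm_apply ((hX.contDiffOn_inChart p₀.proj).comp contDiffOn_fst
      fun z hz ↦ mem_extChartAt_cotangent_target.1 hz)
  have hcomp := (hchart.contDiffAt (extChartAt_target_mem_nhds p₀)).contMDiffAt.comp p₀
    (contMDiffAt_extChartAt (I := cotangentModel E))
  refine hcomp.congr_of_eventuallyEq ?_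
  filter_upwards [extChartAt_source_mem_nhds (I := cotangentModel E) p₀] with p hp
  rw [comp_apply, ← hamiltonianFunction_extChartAt_symm X
    ((extChartAt (cotangentModel E) p₀).map_source hp),
    (extChartAt (cotangentModel E) p₀).left_inv hp]

theorem mfderiv_hamiltonianFunction (hX : IsSmoothVectorField 𝓘(ℝ, E) X)
    (p : CotangentBundle E M) (w : E × (E →L[ℝ] ℝ)) :
    mfderiv (cotangentModel E) 𝓘(ℝ, ℝ) (hamiltonianFunction X) p w =
      w.2 (X p.proj) + covectorValue p
        (fderiv ℝ (vectorFieldInChart 𝓘(ℝ, E) X p.proj) (extChartAt 𝓘(ℝ, E) p.proj p.proj)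
          w.1) := by
  set z := extChartAt (cotangentModel E) p p
  have hz : z = (extChartAt 𝓘(ℝ, E) p.proj p.proj, covectorValue p) := extChartAt_cotangent_self p
  have hfield : DifferentiableAt ℝ (vectorFieldInChart 𝓘(ℝ, E) X p.proj) z.1 :=
    hz ▸ ((hX.contDiffOn_inChart p.proj).contDiffAt
      (extChartAt_target_mem_nhds p.proj)).differentiableAt (by simp)
  have hpairing : HasFDerivAt
      (fun z : E × (E →L[ℝ] ℝ) ↦ z.2 (vectorFieldInChart 𝓘(ℝ, E) X p.proj z.1)) _ z :=
    (hasFDerivAt_snd (𝕜 := ℝ) (p := z)).clm_apply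
      (hfield.hasFDerivAt.comp z (hasFDerivAt_fst (𝕜 := ℝ) (p := z)))
  have hchart : hamiltonianFunction X ∘ (extChartAt (cotangentModel E) p).symm =ᶠ[𝓝 z]
      fun z : E × (E →L[ℝ] ℝ) ↦ z.2 (vectorFieldInChart 𝓘(ℝ, E) X p.proj z.1) := by
    filter_upwards [extChartAt_target_mem_nhds p] with y hy
    exact hamiltonianFunction_extChartAt_symm X hy
  have hmfderiv : (mfderiv (cotangentModel E) 𝓘(ℝ, ℝ) (hamiltonianFunction X) p :
      E × (E →L[ℝ] ℝ) →L[ℝ] ℝ) =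
      fderiv ℝ (hamiltonianFunction X ∘ (extChartAt (cotangentModel E) p).symm) z := by
    rw [((contMDiff_hamiltonianFunction hX).mdifferentiableAt (by simp)).mfderiv,
      ModelWithCorners.range_eq_univ, fderivWithin_univ]
    rfl
  refine congr($(hmfderiv.trans (hchart.fderiv_eq.trans hpairing.fderiv)) w).trans ?_
  rw [hz, add_comm, ← vectorFieldInChart_self (X := X) p.proj]
  rfl

end Hamiltonian

section MixedPartials

variable {V W : Type*} [NormedAddCommGroup V] [NormedSpace ℝ V] [NormedAddCommGroup W]
  [NormedSpace ℝ W] {F : ℝ × V → W} {t : ℝ} {x : V}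

theorem hasDerivAt_fderiv_comp_inr (hF : ContDiffAt ℝ 2 F (t, x)) {f : V → W}
    (hf : ∀ᶠ y in 𝓝 x, HasDerivAt (fun s ↦ F (s, y)) (f y) t) :
    HasDerivAt (fun s ↦ (fderiv ℝ F (s, x)).comp (ContinuousLinearMap.inr ℝ ℝ V))
      (fderiv ℝ f x) t := by
  have hsecond : HasFDerivAt (fderiv ℝ F) (fderiv ℝ (fderiv ℝ F) (t, x)) (t, x) :=
    ((hF.fderiv_right (m := 1) (by norm_num)).differentiableAt (by simp)).hasFDerivAt
  have hdiff : ∀ᶠ y in 𝓝 x, DifferentiableAt ℝ F (t, y) :=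
    (Continuous.prodMk_right t).continuousAt.eventually
      ((hF.eventually (by simp)).mono fun z hz ↦ hz.differentiableAt (by simp))
  have hline (y : V) : HasDerivAt (fun s : ℝ ↦ (s, y)) ((1 : ℝ), (0 : V)) t :=
    (hasDerivAt_id t).prodMk (hasDerivAt_const t y)
  have hf_eq : f =ᶠ[𝓝 x] fun y ↦ fderiv ℝ F (t, y) (1, 0) := by
    filter_upwards [hf, hdiff] with y hy hFy
    exact hy.unique (hFy.hasFDerivAt.comp_hasDerivAt t (hline y))
  have hspace : HasFDerivAt (fun y ↦ fderiv ℝ F (t, y) (1, 0))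
      ((ContinuousLinearMap.apply ℝ W ((1 : ℝ), (0 : V))).comp
        ((fderiv ℝ (fderiv ℝ F) (t, x)).comp (ContinuousLinearMap.inr ℝ ℝ V))) x :=
    (ContinuousLinearMap.apply ℝ W ((1 : ℝ), (0 : V))).hasFDerivAt.comp x
      (hsecond.comp x (hasFDerivAt_prodMk_right t x))
  have htime := ((ContinuousLinearMap.compL ℝ V (ℝ × V) W).flip
    (ContinuousLinearMap.inr ℝ ℝ V)).hasFDerivAt.comp_hasDerivAt t
      (hsecond.comp_hasDerivAt t (hline x))
  refine htime.congr_deriv ?_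
  rw [hf_eq.fderiv_eq, hspace.fderiv]
  ext v
  exact (hF.isSymmSndFDerivAt (by simp)).eq (1, 0) (0, v)

end MixedPartials

section LiftedGenerator

variable {E : Type*} [NormedAddCommGroup E] [NormedSpace ℝ E]

theorem IsSmoothGlobalFlow.hasDerivAt_extChartAt {H : Type*} [TopologicalSpace H]
    {I : ModelWithCorners ℝ E H} {N : Type*} [TopologicalSpace N] [ChartedSpace H N]
    [IsManifold I 1 N] {φ : ℝ → N → N} (hφ : IsSmoothGlobalFlow I φ) (x : N) :
    HasDerivAt (fun t ↦ extChartAt I x (φ t x)) (show E from flowGenerator I φ x) 0 := by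
  have hderiv := hasDerivAt_extChartAt_of_isMIntegralCurve (x₀ := x) (t := 0)
    (hφ.isMIntegralCurve x) ((hφ.zero x).symm ▸ mem_extChartAt_source x)
  rw [hφ.zero, vectorFieldInChart_self] at hderiv
  exact hderiv

variable {M : Type*} [TopologicalSpace M] [ChartedSpace E M]

/-- The expression of a flow in the preferred chart at `q`, as a function of time and space. -/
noncomputable def flowInChart (φ : ℝ → M → M) (q : M) (z : ℝ × E) : E :=
  extChartAt 𝓘(ℝ, E) q (φ z.1 ((extChartAt 𝓘(ℝ, E) q).symm z.2))

namespace IsSmoothGlobalFlow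

variable {φ : ℝ → M → M} (hφ : IsSmoothGlobalFlow 𝓘(ℝ, E) φ)
include hφ

theorem eventually_mem_extChartAt_source (q : M) :
    ∀ᶠ t in 𝓝 (0 : ℝ), φ t q ∈ (extChartAt 𝓘(ℝ, E) q).source := by
  refine (hφ.contMDiff_curve q).continuous.continuousAt.eventually ?_
  simp only [hφ.zero]
  exact extChartAt_source_mem_nhds q

variable [IsManifold 𝓘(ℝ, E) ∞ M]

theorem contDiffAt_flowInChart (q : M) :
    ContDiffAt ℝ ∞ (flowInChart φ q) (0, extChartAt 𝓘(ℝ, E) q q) := by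
  have hsymm : ContMDiffAt 𝓘(ℝ, E) 𝓘(ℝ, E) ∞ (extChartAt 𝓘(ℝ, E) q).symm
      (extChartAt 𝓘(ℝ, E) q q) :=
    (contMDiffOn_extChartAt_symm q).contMDiffAt (extChartAt_target_mem_nhds q)
  have hpair : ContMDiffAt 𝓘(ℝ, ℝ × E) (𝓘(ℝ, ℝ).prod 𝓘(ℝ, E)) ∞
      (fun z : ℝ × E ↦ (z.1, (extChartAt 𝓘(ℝ, E) q).symm z.2)) (0, extChartAt 𝓘(ℝ, E) q q) :=
    contDiff_fst.contMDiff.contMDiffAt.prodMk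
      (ContMDiffAt.comp (g := (extChartAt 𝓘(ℝ, E) q).symm) (f := Prod.snd) (0, _) hsymm
        contDiff_snd.contMDiff.contMDiffAt)
  refine contMDiffAt_iff_contDiffAt.1 (ContMDiffAt.comp (0, _) ?_ (hφ.smooth.contMDiffAt.comp
    (0, _) hpair))
  simp only [extChartAt_to_inv, hφ.zero]
  exact contMDiffAt_extChartAt

theorem hasDerivAt_flowInChart (q : M) {y : E} (hy : y ∈ (extChartAt 𝓘(ℝ, E) q).target) :
    HasDerivAt (fun t ↦ flowInChart φ q (t, y))
      (vectorFieldInChart 𝓘(ℝ, E) (flowGenerator 𝓘(ℝ, E) φ) q y) 0 := by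
  have hzero := hφ.zero ((extChartAt 𝓘(ℝ, E) q).symm y)
  have hderiv := hasDerivAt_extChartAt_of_isMIntegralCurve (x₀ := q) (t := 0)
    (hφ.isMIntegralCurve ((extChartAt 𝓘(ℝ, E) q).symm y))
    (hzero.symm ▸ (extChartAt 𝓘(ℝ, E) q).map_target hy)
  rw [hzero, (extChartAt 𝓘(ℝ, E) q).right_inv hy] at hderiv
  exact hderiv

theorem hasFDerivAt_flowInChart {q : M} {t : ℝ}
    (ht : φ t q ∈ (extChartAt 𝓘(ℝ, E) q).source) :
    HasFDerivAt (fun y ↦ flowInChart φ q (t, y))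
      ((chartDeriv 𝓘(ℝ, E) q (φ t q)).comp (flowDeriv φ t q)) (extChartAt 𝓘(ℝ, E) q q) := by
  have hsymm := hasMFDerivAt_extChartAt_symm (mem_extChartAt_target (I := 𝓘(ℝ, E)) q)
  have hchart := (mdifferentiableAt_extChartAt (I := 𝓘(ℝ, E))
    (extChartAt_source 𝓘(ℝ, E) q ▸ ht)).hasMFDerivAt
  have hflow : HasMFDerivAt 𝓘(ℝ, E) 𝓘(ℝ, E) (extChartAt 𝓘(ℝ, E) q ∘ φ t)
      ((extChartAt 𝓘(ℝ, E) q).symm (extChartAt 𝓘(ℝ, E) q q))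
      ((chartDeriv 𝓘(ℝ, E) q (φ t q)).comp (flowDeriv (E := E) φ t q)) := by
    rw [extChartAt_to_inv]
    exact hchart.comp q (hφ.hasMFDerivAt_time t q)
  refine (hflow.comp _ hsymm).hasFDerivAt.congr_fderiv ?_
  exact congrArg (((chartDeriv 𝓘(ℝ, E) q (φ t q)).comp (flowDeriv φ t q)).comp ·)
    (chartSymmDeriv_self q)

theorem hasDerivAt_chartDeriv_comp_flowDeriv (q : M) :
    HasDerivAt (fun t ↦ (chartDeriv 𝓘(ℝ, E) q (φ t q)).comp (flowDeriv φ t q))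
      (fderiv ℝ (vectorFieldInChart 𝓘(ℝ, E) (flowGenerator 𝓘(ℝ, E) φ) q)
        (extChartAt 𝓘(ℝ, E) q q)) 0 := by
  have hF : ContDiffAt ℝ 2 (flowInChart φ q) (0, extChartAt 𝓘(ℝ, E) q q) :=
    contDiffAt_infty.1 (hφ.contDiffAt_flowInChart q) 2
  have hmixed := hasDerivAt_fderiv_comp_inr hF <| by
    filter_upwards [extChartAt_target_mem_nhds q] with y hy using hφ.hasDerivAt_flowInChart q hy
  have hdiff : ∀ᶠ t in 𝓝 (0 : ℝ),
      DifferentiableAt ℝ (flowInChart φ q) (t, extChartAt 𝓘(ℝ, E) q q) :=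
    (Continuous.prodMk_left _).continuousAt.eventually
      ((hF.eventually (by simp)).mono fun z hz ↦ hz.differentiableAt (by simp))
  refine hmixed.congr_of_eventuallyEq ?_
  filter_upwards [hdiff, hφ.eventually_mem_extChartAt_source q] with t ht hsource
  exact (hφ.hasFDerivAt_flowInChart hsource).unique
    (ht.hasFDerivAt.comp _ (hasFDerivAt_prodMk_right t _))

/-- The lift moves `p` by the inverse of the derivative of the flow, so pairing the lifted covector
with the derivative of the flow gives back `p`. -/
theorem extChartAt_cotangentFlow_snd_comp {p : CotangentBundle E M} {t : ℝ}
    (ht : φ t p.proj ∈ (extChartAt 𝓘(ℝ, E) p.proj).source) :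
    (extChartAt (cotangentModel E) p (cotangentFlow φ t p)).2.comp
      ((chartDeriv 𝓘(ℝ, E) p.proj (φ t p.proj)).comp (flowDeriv φ t p.proj)) =
      covectorValue p := by
  have hchart := chartSymmDeriv_comp_chartDeriv ht
  have hflow : (flowDeriv (E := E) φ (-t) (φ t p.proj)).comp (flowDeriv φ t p.proj) = .id ℝ E := by
    rw [← hφ.flowDeriv_add, neg_add_cancel, hφ.flowDeriv_zero]
  rw [extChartAt_cotangent_apply (p := cotangentFlow φ t p) ht]
  ext v
  exact congr(covectorValue p (flowDeriv φ (-t) (φ t p.proj) ($hchart (flowDeriv φ t p.proj v))))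
    |>.trans congr(covectorValue p ($hflow v))

theorem flowGenerator_cotangentFlow (p : CotangentBundle E M) :
    flowGenerator (cotangentModel E) (cotangentFlow φ) p =
      ((flowGenerator 𝓘(ℝ, E) φ p.proj, -(covectorValue p).comp
        (fderiv ℝ (vectorFieldInChart 𝓘(ℝ, E) (flowGenerator 𝓘(ℝ, E) φ) p.proj)
          (extChartAt 𝓘(ℝ, E) p.proj p.proj))) : E × (E →L[ℝ] ℝ)) := by
  have hlift := hφ.isSmoothGlobalFlow_cotangentFlow.hasDerivAt_extChartAt p
  have hsource := hφ.eventually_mem_extChartAt_source p.proj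
  refine Prod.ext ?_ ?_
  · refine HasDerivAt.unique (f := fun t ↦ (extChartAt (cotangentModel E) p
      (cotangentFlow φ t p)).1) hlift.fst ?_
    refine (hφ.hasDerivAt_extChartAt p.proj).congr_of_eventuallyEq (hsource.mono fun t ht ↦ ?_)
    exact congrArg Prod.fst (extChartAt_cotangent_apply (p := cotangentFlow φ t p) ht)
  · have hpairing := HasDerivAt.clm_comp (c := fun t ↦ (extChartAt (cotangentModel E) p
      (cotangentFlow φ t p)).2) hlift.snd (hφ.hasDerivAt_chartDeriv_comp_flowDeriv p.proj)
    have hconst := hpairing.unique ((hasDerivAt_const 0 (covectorValue p)).congr_of_eventuallyEq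
      (hsource.mono fun t ht ↦ hφ.extChartAt_cotangentFlow_snd_comp ht))
    rw [hφ.zero, chartDeriv_self, hφ.flowDeriv_zero, ContinuousLinearMap.comp_id,
      ContinuousLinearMap.comp_id, hφ.isSmoothGlobalFlow_cotangentFlow.zero,
      extChartAt_cotangent_self] at hconst
    exact eq_neg_of_add_eq_zero_left hconst

theorem isHamiltonianVectorField_flowGenerator_cotangentFlow [FiniteDimensional ℝ E] :
    IsHamiltonianVectorField (cotangentModel E) (canonicalForm E M)
      (flowGenerator (cotangentModel E) (cotangentFlow φ))
      (hamiltonianFunction (flowGenerator 𝓘(ℝ, E) φ)) where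
  symplectic := isSymplecticForm_canonicalForm E M
  smooth_field := hφ.isSmoothGlobalFlow_cotangentFlow.isSmoothVectorField_generator
  smooth_hamiltonian := contMDiff_hamiltonianFunction hφ.isSmoothVectorField_generator
  contraction p w := by
    refine Eq.trans ?_ (mfderiv_hamiltonianFunction hφ.isSmoothVectorField_generator p w).symm
    rw [hφ.flowGenerator_cotangentFlow p]
    refine congr($(formValue_canonicalForm E M p) ![_, w]).trans
      ((modelCanonicalForm_apply E _ w).trans ?_)
    rw [neg_apply, sub_neg_eq_add, ContinuousLinearMap.comp_apply]

end IsSmoothGlobalFlow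

end LiftedGenerator

theorem mainTheorem8 {E : Type*} [NormedAddCommGroup E] [NormedSpace ℝ E] [FiniteDimensional ℝ E]
    {M : Type*} [TopologicalSpace M] [T2Space M] [ChartedSpace E M]
    [IsManifold 𝓘(ℝ, E) ∞ M]
    (X : (q : M) → TangentSpace 𝓘(ℝ, E) q) (hXs : IsSmoothVectorField 𝓘(ℝ, E) X)
    (hX : IsCompleteVectorField 𝓘(ℝ, E) X) :
    -- the flow of `X` is a smooth global flow, and so are its lifts to the cotangent bundle
    IsSmoothGlobalFlow 𝓘(ℝ, E) (flowOf 𝓘(ℝ, E) X hX) ∧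
    IsSmoothGlobalFlow (cotangentModel E)
      (fun t (p : CotangentBundle E M) ↦ liftCotangent (flowEquiv 𝓘(ℝ, E) X hXs hX t) p) ∧
    -- the cotangent lift is a smooth complete vector field, which generates the lifted flow
    IsSmoothVectorField (cotangentModel E) (cotangentLift X hXs hX) ∧
    (∃ hL : IsCompleteVectorField (cotangentModel E) (cotangentLift X hXs hX),
      ∀ (t : ℝ) (p : CotangentBundle E M),
        flowOf (cotangentModel E) (cotangentLift X hXs hX) hL t p =
          liftCotangent (flowEquiv 𝓘(ℝ, E) X hXs hX t) p) ∧
    -- it is Hamiltonian for the canonical symplectic form, with Hamiltonian `p_q ↦ p (X_q)`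
    IsHamiltonianVectorField (cotangentModel E) (canonicalForm E M) (cotangentLift X hXs hX)
      (hamiltonianFunction X) := by
  have : T2Space (CotangentBundle E M) :=
    t2Space_totalSpace (E →L[ℝ] ℝ) (fun x : M ↦ TangentSpace 𝓘(ℝ, E) x →L[ℝ] Trivial M ℝ x)
  have hφ := hXs.isSmoothGlobalFlow_flowOf hX
  have hψ := hφ.isSmoothGlobalFlow_cotangentFlow
  have hham := hφ.isHamiltonianVectorField_flowGenerator_cotangentFlow
  rw [flowGenerator_flowOf] at hham
  simp only [liftCotangent_flowEquiv, cotangentLift_eq_flowGenerator]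
  exact ⟨hφ, hψ, hψ.isSmoothVectorField_generator,
    ⟨hψ.isCompleteVectorField_generator, fun t p ↦ congr($(hψ.flowOf_generator _) t p)⟩, hham⟩
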